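/- All graphs are finite, undirected, simple and node-labelled: a graph of dimension $d$ is $G=(V,E,\lambda)$ with $E$ symmetric and irreflexive and $\lambda:V\to\{0,1\}^d$. A node classifier of dimension $d$ is a property of pairs $(G,v)$, where $G$ is such a graph and $v$ is a node of $G$. A formula or a GNN expresses a node classifier $\mathcal C$ if it gives the same answer as $\mathcal C$ on all such pairs. * FO is first-order logic with equality, a binary predicate for $E$ and unary predicates $P_1,\dots,P_d$ with $P_i=\{v:\lambda(v)_i=1\}$. $\mathrm C^2$ consists of the formulas with at most two variables $x,y$ built from these atoms with Boolean connectives and counting quantifiers $\exists_k$ ("for at least $k$ nodes"), $k\in\mathbb N$. Node classifiers are defined by formulas $\varphi(x)$ with exactly one free variable. * An ACR-GNN classifier of dimension $d$ consists of finitely many layers $(\mathsf{agg},\mathsf{comb},\mathsf{read})$ of matching dimensions and a function $\mathsf{cls}$ from real vectors to truth values. Here $\mathsf{agg}$ and $\mathsf{read}$ are arbitrary functions from finite multisets of real vectors to real vectors, and $\mathsf{comb}$ is an arbitrary function from vectors to vectors. Starting from $\lambda$, each layer replaces the current labelling $\lambda$ by $$\lambda'(v)=\mathsf{comb}\Big(\lambda(v),\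 \mathsf{agg}(\{\!\{\lambda(w)\}\!\}_{w\in N_G(v)}),\ \mathsf{read}(\{\!\{\lambda(w)\}\!\}_{w\in V})\Big),$$ and the output at $v$ is $\mathsf{cls}$ of the final label of $v$. * The gadgetisation $\mathsf{gad}(G')$ of a finite directed loopless graph $G'=(V',E')$ is the undirected graph of dimension $3$ with a node $v^1_u$ labelled $(1,0,0)$ for each $u\in V'$ and, for each directed edge $(u,w)\in E'$, two nodes $v^2_{(u,w)}$ labelled $(0,1,0)$ and $v^3_{(u,w)}$ labelled $(0,0,1)$ and the three undirected edges $\{v^1_u,v^2_{(u,w)}\}$, $\{v^2_{(u,w)},v^3_{(u,w)}\}$, $\{v^3_{(u,w)},v^1_w\}$. * $\varphi_{\mathit{GadLin}}$ is the node classifier of dimension $3$ that accepts a node of $G$ if and only if $G$ is isomorphic to $\mathsf{gad}(G')$ for some $G'$ whose edge relation is a strict linear order on its finite set of nodes. **Corollary.** Over undirected graphs, there are FO node classifiers that are expressible by ACR-GNNs but not expressible in $\mathrm C^2$. In particular, $\varphi_{\mathit{GadLin}}$ is such a classifier: it is expressible in FO and by an ACR-GNN, but not in $\mathrm C^2$.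 Consequently, the open problem of Barceló et al. has a negative answer: it is not the case that the node classifiers expressible both in FO and by ACR-GNNs are exactly those expressible in $\mathrm C^2$. -/

import Mathlib

/-! ### Graphs -/

/-- A directed, loopless, node-labelled graph of dimension `d` on the node set `V`. -/
structure LabelledDigraph (d : ℕ) (V : Type) where
  edge : V → V → Prop
  irrefl : ∀ v, ¬ edge v v
  label : V → Fin d → Bool

/-- An undirected (simple) node-labelled graph of dimension `d` on the node set `V`. -/
structure LabelledGraph (d : ℕ) (V : Type) extends SimpleGraph V where
  label : V → Fin d → Bool

/-- Isomorphism of node-labelled undirected graphs. -/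
def LabelledGraph.IsIso {d : ℕ} {V W : Type} (G : LabelledGraph d V)
    (H : LabelledGraph d W) : Prop :=
  ∃ f : G.toSimpleGraph ≃g H.toSimpleGraph, ∀ v, H.label (f v) = G.label v

/-- A node classifier over finite undirected graphs of dimension `d`: a property of pairs
(graph, node). -/
def NodeClassifier (d : ℕ) : Type 1 :=
  ∀ (V : Type) [Fintype V], LabelledGraph d V → V → Prop

/-- Two node classifiers agree on all nodes of all finite undirected graphs. -/
def NodeClassifier.Agree {d : ℕ} (A B : NodeClassifier d) : Prop :=
  ∀ (V : Type) [Fintype V] (G : LabelledGraph d V) (v : V), A V G v ↔ B V G v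

/-! ### Aggregate-combine-readout graph neural networks -/

/-- A layer turning labellings by vectors of dimension `m` into labellings by vectors of
dimension `n`. -/
structure ACRLayer (m n : ℕ) where
  aggDim : ℕ
  readDim : ℕ
  agg : Multiset (Fin m → ℝ) → (Fin aggDim → ℝ)
  read : Multiset (Fin m → ℝ) → (Fin readDim → ℝ)
  comb : (Fin m → ℝ) → (Fin aggDim → ℝ) → (Fin readDim → ℝ) → (Fin n → ℝ)

open Classical in
/-- The new labelling computed by a layer on a finite undirected graph. -/
noncomputable def ACRLayer.apply {m n : ℕ} (A : ACRLayer m n) {V : Type} [Fintype V]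
    (G : SimpleGraph V) (x : V → Fin m → ℝ) : V → Fin n → ℝ :=
  fun v => A.comb (x v)
    (A.agg ((Finset.univ.filter fun w => G.Adj v w).val.map x))
    (A.read ((Finset.univ : Finset V).val.map x))

/-- A finite sequence of layers of matching dimensions. -/
inductive ACRLayers : ℕ → ℕ → Type
  | nil (n : ℕ) : ACRLayers n n
  | cons {m k n : ℕ} (A : ACRLayer m k) (rest : ACRLayers k n) : ACRLayers m n

/-- Successive application of the layers, the head of the sequence first. -/
noncomputable def ACRLayers.apply {V : Type} [Fintype V] (G : SimpleGraph V) :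
    {m n : ℕ} → ACRLayers m n → (V → Fin m → ℝ) → (V → Fin n → ℝ)
  | _, _, .nil _, x => x
  | _, _, .cons A rest, x => rest.apply G (A.apply G x)

/-- An ACR-GNN classifier of dimension `d`. -/
structure ACRGNN (d : ℕ) where
  outDim : ℕ
  layers : ACRLayers d outDim
  cls : (Fin outDim → ℝ) → Bool

/-- The node classifier computed by an ACR-GNN; the initial labelling consists of the binary
label vectors of the graph. -/
def ACRGNN.classifier {d : ℕ} (N : ACRGNN d) : NodeClassifier d :=
  fun _ _ G v =>
    N.cls (N.layers.apply G.toSimpleGraph (fun w i => if G.label w i then 1 else 0) v) = true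

/-! ### First-order logic -/

/-- Relation symbols: one binary symbol for edges and unary symbols for the labels. -/
inductive GraphRel (d : ℕ) : ℕ → Type
  | edge : GraphRel d 2
  | label (i : Fin d) : GraphRel d 1

/-- The first-order language of node-labelled graphs of dimension `d`. -/
def graphLanguage (d : ℕ) : FirstOrder.Language :=
  ⟨fun _ => Empty, GraphRel d⟩

/-- The first-order structure of a graph. -/
@[reducible] def LabelledGraph.toStructure {d : ℕ} {V : Type} (G : LabelledGraph d V) :
    (graphLanguage d).Structure V where
  funMap := fun f _ => Empty.elim f
  RelMap := fun R a =>
    match R, a with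
    | GraphRel.edge, a => G.Adj (a 0) (a 1)
    | GraphRel.label i, a => G.label (a 0) i = true

/-- First-order formulas (with equality) with exactly one free variable. -/
def FOFormula (d : ℕ) : Type :=
  {φ : (graphLanguage d).Formula (Fin 1) // φ.freeVarFinset = {0}}

/-- The node classifier defined by a first-order formula. -/
def FOFormula.classifier {d : ℕ} (φ : FOFormula d) : NodeClassifier d :=
  fun V _ G v =>
    letI : (graphLanguage d).Structure V := G.toStructure
    φ.1.Realize (fun _ => v)

/-! ### Two-variable logic with counting -/

/-- Formulas over the two variables `0` and `1`; `existsAtLeast k i φ` says that `φ` holds for at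
least `k` values of the variable `i`. -/
inductive C2Formula (d : ℕ) : Type
  | equal (i j : Fin 2) : C2Formula d
  | edge (i j : Fin 2) : C2Formula d
  | label (p : Fin d) (i : Fin 2) : C2Formula d
  | neg (φ : C2Formula d) : C2Formula d
  | and (φ ψ : C2Formula d) : C2Formula d
  | existsAtLeast (k : ℕ) (i : Fin 2) (φ : C2Formula d) : C2Formula d

/-- The free variables of a formula. -/
def C2Formula.freeVars {d : ℕ} : C2Formula d → Finset (Fin 2)
  | .equal i j => {i, j}
  | .edge i j => {i, j}
  | .label _ i => {i}
  | .neg φ => φ.freeVars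
  | .and φ ψ => φ.freeVars ∪ ψ.freeVars
  | .existsAtLeast _ i φ => φ.freeVars.erase i

/-- Satisfaction of a formula in a graph under an assignment of the two variables. -/
def C2Formula.Sat {d : ℕ} {V : Type} (G : LabelledGraph d V) : C2Formula d → (Fin 2 → V) → Prop
  | .equal i j, s => s i = s j
  | .edge i j, s => G.Adj (s i) (s j)
  | .label p i, s => G.label (s i) p = true
  | .neg φ, s => ¬ φ.Sat G s
  | .and φ ψ, s => φ.Sat G s ∧ ψ.Sat G s
  | .existsAtLeast k i φ, s =>
      ∃ S : Finset V, S.card = k ∧ ∀ w ∈ S, φ.Sat G (Function.update s i w)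

/-- The node classifier defined by a formula; it is used for formulas whose only free variable is
`0`, so that the value assigned to the variable `1` is irrelevant. -/
def C2Formula.classifier {d : ℕ} (φ : C2Formula d) : NodeClassifier d :=
  fun _ _ G v => φ.Sat G (fun _ => v)

/-! ### Expressibility over undirected graphs -/

def FOExpressible {d : ℕ} (A : NodeClassifier d) : Prop :=
  ∃ φ : FOFormula d, φ.classifier.Agree A

def ACRExpressible {d : ℕ} (A : NodeClassifier d) : Prop :=
  ∃ N : ACRGNN d, N.classifier.Agree A

def C2Expressible {d : ℕ} (A : NodeClassifier d) : Prop :=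
  ∃ φ : C2Formula d, φ.freeVars = {0} ∧ φ.classifier.Agree A

/-! ### Gadgetised linear orders -/

/-- Nodes of the gadgetisation: `one u` for every node `u`, and `two u w`, `three u w` for every
edge `(u, w)`. -/
inductive GadNode {d : ℕ} {V : Type} (D : LabelledDigraph d V) : Type
  | one (u : V) : GadNode D
  | two (u w : V) (h : D.edge u w) : GadNode D
  | three (u w : V) (h : D.edge u w) : GadNode D

/-- The three edges that replace an edge `(u, w)`, each listed in one direction. -/
inductive GadEdge {d : ℕ} {V : Type} (D : LabelledDigraph d V) : GadNode D → GadNode D → Prop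
  | first (u w : V) (h : D.edge u w) : GadEdge D (.one u) (.two u w h)
  | second (u w : V) (h : D.edge u w) : GadEdge D (.two u w h) (.three u w h)
  | third (u w : V) (h : D.edge u w) : GadEdge D (.three u w h) (.one w)

/-- The gadgetisation of a directed graph. -/
def gad {d : ℕ} {V : Type} (D : LabelledDigraph d V) : LabelledGraph 3 (GadNode D) where
  Adj x y := GadEdge D x y ∨ GadEdge D y x
  symm := ⟨fun _ _ h => h.symm⟩
  loopless := ⟨fun x h => by rcases h with h | h <;> cases h⟩
  label
    | .one _ => ![true, false, false]
    | .two _ _ _ => ![false, true, false]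
    | .three _ _ _ => ![false, false, true]

/-- The node classifier that accepts the nodes of a graph exactly if the graph is isomorphic to
the gadgetisation of some finite strict linear order. -/
def gadLin : NodeClassifier 3 :=
  fun _ _ G _ => ∃ (d : ℕ) (W : Type) (_ : Finite W) (D : LabelledDigraph d W),
    IsStrictTotalOrder W D.edge ∧ G.IsIso (gad D)

/-!
A graph is a gadgetised strict linear order iff its nodes labelled `(0,1,0)` and `(0,0,1)` pair up
into gadgets, at most one for each pair of ends, and the relation that the gadgets represent is a
strict linear order on the nodes labelled `(1,0,0)`. Every part of this is first-order.

An ACR-GNN cannot follow transitivity, but it can count. In a strict linear order on `n` elements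
the out-degrees are `0, …, n - 1`, each taken once, and the successors of an element of out-degree
`m` are exactly the elements of smaller out-degree. Conversely, if the out-degrees are distinct and
the successors of every node of out-degree `m` have the out-degrees `0, …, m - 1`, then there is an
edge from `u` to `w` iff `w` has smaller out-degree than `u`, so the edge relation is a strict
linear order. A successor is three undirected steps away, so boundedly many layers propagate its
out-degree, and a readout verifies both conditions globally.

For `C²`, take a long linear order and move the end of one gadget between two adjacent central
positions, so that it becomes a loop. To a formula of bounded depth that counts up to `k`, the
central positions look alike: of the gadgets that touch a central position, those whose other end
is central are too many, adjacent or not, to be counted, and the others are determined by their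
other end. Hence no formula of `C²` separates the gadgetised order from the redirected graph, which
is not a gadgetised order. Pebble-game strategies appear as colourings of the nodes, one for each
number of remaining rounds.
-/

/-! ### Node features computed by ACR-GNNs -/

/-- A property of nodes with values in `α`, such as the number of neighbours of a node. -/
abbrev NodeFeature (d : ℕ) (α : Type) : Type 1 :=
  ∀ (V : Type) [Fintype V], LabelledGraph d V → V → α

namespace LabelledGraph

/-- The labelling by real vectors that an ACR-GNN starts from. -/
def initialLabelling {d : ℕ} {V : Type} (G : LabelledGraph d V) (v : V) (i : Fin d) : ℝ :=
  if G.label v i then 1 else 0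

open Classical in
/-- The neighbours of a node whose label has a `1` at position `i`. -/
noncomputable def labelNbrs {d : ℕ} {V : Type} [Fintype V] (G : LabelledGraph d V) (i : Fin d)
    (v : V) : Finset V :=
  {w | G.Adj v w ∧ G.label w i = true}

theorem mem_labelNbrs {d : ℕ} {V : Type} [Fintype V] {G : LabelledGraph d V} {i : Fin d}
    {v w : V} : w ∈ G.labelNbrs i v ↔ G.Adj v w ∧ G.label w i = true := by
  simp [labelNbrs]

end LabelledGraph

namespace ACRLayers

/-- A sequence of layers followed by one more layer. -/
def snoc : {m k n : ℕ} → ACRLayers m k → ACRLayer k n → ACRLayers m n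
  | _, _, _, .nil _, B => .cons B (.nil _)
  | _, _, _, .cons A rest, B => .cons A (rest.snoc B)

theorem apply_snoc {V : Type} [Fintype V] (G : SimpleGraph V) {m k n : ℕ} (L : ACRLayers m k)
    (B : ACRLayer k n) (x : V → Fin m → ℝ) :
    (L.snoc B).apply G x = B.apply G (L.apply G x) := by
  induction L with
  | nil => rfl
  | cons A _ ih => exact ih B _

end ACRLayers

theorem exists_injective_fin_one_real (β : Type) [Countable β] :
    ∃ e : β → Fin 1 → ℝ, Function.Injective e := by
  obtain ⟨e, he⟩ := exists_injective_nat β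
  exact ⟨fun b _ => e b, fun a b h => he (Nat.cast_injective (congrFun h 0))⟩

namespace NodeFeature

variable {d : ℕ} {α β : Type}

open Classical in
/-- The values of a feature at the neighbours of a node. -/
noncomputable def nbrs (f : NodeFeature d α) : NodeFeature d (Multiset α) :=
  fun V _ G v => (Finset.univ.filter fun w => G.Adj v w).val.map (f V G)

/-- The values of a feature at all nodes. -/
def all (f : NodeFeature d α) : NodeFeature d (Multiset α) :=
  fun V _ G _ => (Finset.univ : Finset V).val.map (f V G)

/-- A feature that can be read off the labels computed by some sequence of ACR-GNN layers. -/
def IsACRComputable (f : NodeFeature d α) : Prop :=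
  ∃ (n : ℕ) (L : ACRLayers d n) (g : (Fin n → ℝ) → α),
    ∀ (V : Type) [Fintype V] (G : LabelledGraph d V) (v : V),
      f V G v = g (L.apply G.toSimpleGraph G.initialLabelling v)

theorem isACRComputable_label :
    IsACRComputable (fun _ _ G v => G.label v : NodeFeature d (Fin d → Bool)) := by
  classical
  refine ⟨d, .nil d, fun x i => decide (x i = 1), fun V _ G v => funext fun i => ?_⟩
  cases h : G.label v i <;> simp [ACRLayers.apply, LabelledGraph.initialLabelling, h]

namespace IsACRComputable

theorem of_eq_comp {f : NodeFeature d α} (hf : f.IsACRComputable) (g : α → β)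
    {f' : NodeFeature d β}
    (h : ∀ (V : Type) [Fintype V] (G : LabelledGraph d V) (v : V), f' V G v = g (f V G v)) :
    f'.IsACRComputable := by
  obtain ⟨n, L, r, hr⟩ := hf
  exact ⟨n, L, g ∘ r, fun V _ G v => by rw [h, hr, Function.comp_apply]⟩

/-- Aggregation, readout and combination are arbitrary functions, so one more layer can store all
that a node sees in a single real number. -/
theorem prod_nbrs_all [Countable α] [Nonempty α] {f : NodeFeature d α}
    (hf : f.IsACRComputable) :
    IsACRComputable (fun V _ G v => (f V G v, f.nbrs V G v, f.all V G v) :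
      NodeFeature d (α × Multiset α × Multiset α)) := by
  obtain ⟨n, L, g, hg⟩ := hf
  obtain ⟨e₁, he₁⟩ := exists_injective_fin_one_real (Multiset α)
  obtain ⟨e₂, he₂⟩ := exists_injective_fin_one_real (α × Multiset α × Multiset α)
  let B : ACRLayer n 1 :=
    { aggDim := 1
      readDim := 1
      agg := fun M => e₁ (M.map g)
      read := fun M => e₁ (M.map g)
      comb := fun x a r => e₂ (g x, Function.invFun e₁ a, Function.invFun e₁ r) }
  refine ⟨1, L.snoc B, Function.invFun e₂, fun V _ G v => ?_⟩
  have hf : f V G = g ∘ L.apply G.toSimpleGraph G.initialLabelling := funext fun v => hg V G v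
  simp only [ACRLayers.apply_snoc, ACRLayer.apply, B, Function.leftInverse_invFun he₁ _,
    Function.leftInverse_invFun he₂ _, Multiset.map_map, nbrs, all, hf, Function.comp_apply]

theorem prod_labelNbrs [Countable α] [Nonempty α] {f : NodeFeature d α}
    (hf : IsACRComputable (fun V _ G v => (G.label v, f V G v) :
      NodeFeature d ((Fin d → Bool) × α))) :
    IsACRComputable (fun V _ G v =>
      (G.label v, f V G v, fun i => (G.labelNbrs i v).val.map (f V G)) :
      NodeFeature d ((Fin d → Bool) × α × (Fin d → Multiset α))) := by
  refine hf.prod_nbrs_all.of_eq_comp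
    (fun x => (x.1.1, x.1.2, fun i => (x.2.1.filter fun y => y.1 i = true).map Prod.snd))
    fun V _ G v => ?_
  simp only [nbrs, Multiset.filter_map, Multiset.map_map, Function.comp_def,
    LabelledGraph.labelNbrs, ← Finset.filter_val, Finset.filter_filter]

theorem acrExpressible {A : NodeClassifier d} (hA : IsACRComputable (A : NodeFeature d Prop)) :
    ACRExpressible A := by
  classical
  obtain ⟨n, L, g, hg⟩ := hA
  refine ⟨⟨n, L, fun x => decide (g x)⟩, fun V _ G v => ?_⟩
  rw [hg]
  exact decide_eq_true_iff

end IsACRComputable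

end NodeFeature

/-! ### First-order formulas over graphs -/

section FirstOrder

open FirstOrder Language

variable {d n : ℕ} {α V W : Type}

/-- The atomic formula for an edge between two bound variables. -/
def edgeFormula (i j : Fin n) : (graphLanguage d).BoundedFormula α n :=
  Relations.boundedFormula₂ (L := graphLanguage d) (GraphRel.edge : GraphRel d 2) (&i) (&j)

/-- The atomic formula for a unary predicate at a bound variable. -/
def labelFormula (p : Fin d) (i : Fin n) : (graphLanguage d).BoundedFormula α n :=
  Relations.boundedFormula₁ (L := graphLanguage d) (GraphRel.label p : GraphRel d 1) (&i)

theorem realize_edgeFormula (G : LabelledGraph d V) {i j : Fin n} {v : α → V} {xs : Fin n → V} :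
    letI := G.toStructure
    (edgeFormula i j : (graphLanguage d).BoundedFormula α n).Realize v xs ↔
      G.Adj (xs i) (xs j) :=
  letI := G.toStructure
  BoundedFormula.realize_rel₂

theorem realize_labelFormula (G : LabelledGraph d V) {p : Fin d} {i : Fin n} {v : α → V}
    {xs : Fin n → V} :
    letI := G.toStructure
    (labelFormula p i : (graphLanguage d).BoundedFormula α n).Realize v xs ↔
      G.label (xs i) p = true :=
  letI := G.toStructure
  BoundedFormula.realize_rel₁

/-- Truth of a first-order sentence in a graph. -/
def LabelledGraph.Models (G : LabelledGraph d V) (φ : (graphLanguage d).Sentence) : Prop :=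
  letI := G.toStructure
  V ⊨ φ

theorem LabelledGraph.IsIso.models_iff {G : LabelledGraph d V} {H : LabelledGraph d W}
    (h : G.IsIso H) (φ : (graphLanguage d).Sentence) : G.Models φ ↔ H.Models φ := by
  obtain ⟨f, hf⟩ := h
  let _ := G.toStructure
  let _ := H.toStructure
  have map_rel : ∀ {m : ℕ} (R : (graphLanguage d).Relations m) (xs : Fin m → V),
      Structure.RelMap R (f ∘ xs) ↔ Structure.RelMap R xs
    | _, GraphRel.edge, xs => f.map_adj_iff
    | _, GraphRel.label p, xs => by
      change H.label (f (xs 0)) p = true ↔ G.label (xs 0) p = true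
      rw [hf]
  let e : V ≃[graphLanguage d] W :=
    { f.toEquiv with
      map_fun' := fun F => F.elim
      map_rel' := map_rel }
  exact StrongHomClass.realize_sentence e φ

/-- The conjunct `x = x` provides the free variable that a sentence lacks. -/
theorem foExpressible_of_sentence {A : NodeClassifier d} (φ : (graphLanguage d).Sentence)
    (hφ : ∀ (V : Type) [Fintype V] (G : LabelledGraph d V) (v : V), G.Models φ ↔ A V G v) :
    FOExpressible A := by
  let x : (graphLanguage d).Term (Fin 1) := Term.var 0
  let ψ : (graphLanguage d).Formula (Fin 1) := φ.relabel Empty.elim ⊓ x.equal x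
  have eq_free : (x.equal x).freeVarFinset = {0} := by
    simp [x, Term.equal, Term.bdEqual, BoundedFormula.freeVarFinset]
  have free : ψ.freeVarFinset = {0} := by
    refine Finset.Subset.antisymm (fun i _ => by simp [Subsingleton.elim i 0]) ?_
    change _ ⊆ (_ ∪ (BoundedFormula.freeVarFinset _ ∪ ∅)) ∪ ∅
    rw [eq_free]
    simp
  refine ⟨⟨ψ, free⟩, fun V _ G v => ?_⟩
  let _ := G.toStructure
  rw [← hφ V G v]
  change ψ.Realize (fun _ => v) ↔ V ⊨ φ
  rw [Formula.Realize, BoundedFormula.realize_inf]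
  change (Formula.Realize _ _ ∧ Formula.Realize _ _) ↔ _
  rw [Formula.realize_relabel, Formula.realize_equal, and_iff_left rfl,
    Subsingleton.elim (_ ∘ _) (default : Empty → V)]
  rfl

end FirstOrder

/-! ### First-order axioms for gadgetised linear orders -/

/-- A label vector with exactly one `1`. -/
def IsOneHot {d : ℕ} (l : Fin d → Bool) : Prop :=
  ∃ i, ∀ j, l j = true ↔ j = i

namespace IsOneHot

variable {d : ℕ} {l l' : Fin d → Bool} {i j : Fin d}

theorem eq_of_eq_true (h : IsOneHot l) (hi : l i = true) (hj : l j = true) : i = j := by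
  obtain ⟨k, hk⟩ := h
  rw [(hk i).1 hi, (hk j).1 hj]

theorem ext (h : IsOneHot l) (h' : IsOneHot l') (hi : l i = true) (hi' : l' i = true) :
    l = l' := by
  obtain ⟨k, hk⟩ := h
  obtain ⟨k', hk'⟩ := h'
  funext j
  rw [Bool.eq_iff_iff, hk, hk', ← (hk i).1 hi, ← (hk' i).1 hi']

end IsOneHot

namespace LabelledGraph

variable {V : Type}

/-- The nodes `u`, `a`, `b`, `w` form a gadget that represents the directed edge `(u, w)`. -/
structure IsGadget (G : LabelledGraph 3 V) (u a b w : V) : Prop where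
  label_source : G.label u 0 = true
  label_two : G.label a 1 = true
  label_three : G.label b 2 = true
  label_target : G.label w 0 = true
  adj_source : G.Adj u a
  adj_two_three : G.Adj a b
  adj_target : G.Adj b w

/-- Some gadget represents the directed edge `(u, w)`. -/
def Represents (G : LabelledGraph 3 V) (u w : V) : Prop :=
  ∃ a b, G.IsGadget u a b w

/-- First-order axioms that characterise the gadgetisations of strict linear orders. -/
structure IsGadLin (G : LabelledGraph 3 V) : Prop where
  isOneHot : ∀ v, IsOneHot (G.label v)
  exists_isGadget_of_two : ∀ a, G.label a 1 = true → ∃ u b w, G.IsGadget u a b w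
  exists_isGadget_of_three : ∀ b, G.label b 2 = true → ∃ u a w, G.IsGadget u a b w
  adj_two : ∀ u a b w, G.IsGadget u a b w → ∀ x, G.Adj a x → x = u ∨ x = b
  adj_three : ∀ u a b w, G.IsGadget u a b w → ∀ x, G.Adj b x → x = a ∨ x = w
  not_adj_one : ∀ x y, G.label x 0 = true → G.label y 0 = true → ¬ G.Adj x y
  two_unique : ∀ u a b w a' b', G.IsGadget u a b w → G.IsGadget u a' b' w → a = a'
  irrefl : ∀ u, ¬ G.Represents u u
  trans : ∀ u w x, G.Represents u w → G.Represents w x → G.Represents u x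
  total : ∀ u w, G.label u 0 = true → G.label w 0 = true → u ≠ w →
    G.Represents u w ∨ G.Represents w u

end LabelledGraph

section Formulas

open FirstOrder Language LabelledGraph

variable {d n : ℕ} {α V W : Type}

/-- The formula that defines `IsOneHot`. -/
noncomputable def oneHotFormula (i : Fin n) : (graphLanguage d).BoundedFormula α n :=
  BoundedFormula.iSup fun p : Fin d => BoundedFormula.iInf fun q : Fin d =>
    if q = p then labelFormula q i else ∼(labelFormula q i)

/-- The formula that defines `LabelledGraph.IsGadget`. -/
def gadgetFormula (u a b w : Fin n) : (graphLanguage 3).BoundedFormula α n :=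
  labelFormula 0 u ⊓ labelFormula 1 a ⊓ labelFormula 2 b ⊓ labelFormula 0 w ⊓
    edgeFormula u a ⊓ edgeFormula a b ⊓ edgeFormula b w

/-- The formula that defines `LabelledGraph.Represents`. -/
def representsFormula (u w : Fin n) : (graphLanguage 3).BoundedFormula α n :=
  ∃' ∃' gadgetFormula u.castSucc.castSucc (Fin.last n).castSucc (Fin.last (n + 1))
    w.castSucc.castSucc

theorem realize_oneHotFormula (G : LabelledGraph d V) {i : Fin n} {v : α → V} {xs : Fin n → V} :
    letI := G.toStructure
    (oneHotFormula i : (graphLanguage d).BoundedFormula α n).Realize v xs ↔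
      IsOneHot (G.label (xs i)) := by
  simp only [oneHotFormula, BoundedFormula.realize_iSup, BoundedFormula.realize_iInf]
  refine exists_congr fun p => forall_congr' fun q => ?_
  by_cases h : q = p <;> simp [h, realize_labelFormula G]

theorem realize_gadgetFormula (G : LabelledGraph 3 V) {u a b w : Fin n} {v : α → V}
    {xs : Fin n → V} :
    letI := G.toStructure
    (gadgetFormula u a b w : (graphLanguage 3).BoundedFormula α n).Realize v xs ↔
      G.IsGadget (xs u) (xs a) (xs b) (xs w) := by
  simp only [gadgetFormula, BoundedFormula.realize_inf, realize_labelFormula G,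
    realize_edgeFormula G, and_assoc]
  exact ⟨fun ⟨h₁, h₂, h₃, h₄, h₅, h₆, h₇⟩ => ⟨h₁, h₂, h₃, h₄, h₅, h₆, h₇⟩,
    fun ⟨h₁, h₂, h₃, h₄, h₅, h₆, h₇⟩ => ⟨h₁, h₂, h₃, h₄, h₅, h₆, h₇⟩⟩

theorem realize_representsFormula (G : LabelledGraph 3 V) {u w : Fin n} {v : α → V}
    {xs : Fin n → V} :
    letI := G.toStructure
    (representsFormula u w : (graphLanguage 3).BoundedFormula α n).Realize v xs ↔
      G.Represents (xs u) (xs w) := by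
  simp only [representsFormula, BoundedFormula.realize_ex, realize_gadgetFormula G,
    Fin.snoc_castSucc, Fin.snoc_last, Represents]

/-- The conjunction of the axioms `LabelledGraph.IsGadLin`, in the same order. -/
noncomputable def gadLinSentence : (graphLanguage 3).Sentence :=
  (∀' oneHotFormula (0 : Fin 1)) ⊓
  (∀' (labelFormula 1 0 ⟹ ∃' ∃' ∃' gadgetFormula 1 0 2 (3 : Fin 4))) ⊓
  (∀' (labelFormula 2 0 ⟹ ∃' ∃' ∃' gadgetFormula 1 2 0 (3 : Fin 4))) ⊓
  (∀' ∀' ∀' ∀' (gadgetFormula 0 1 2 3 ⟹ ∀' (edgeFormula 1 4 ⟹ (&4 =' &0) ⊔ (&4 =' &2)))) ⊓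
  (∀' ∀' ∀' ∀' (gadgetFormula 0 1 2 3 ⟹ ∀' (edgeFormula 2 4 ⟹ (&4 =' &1) ⊔ (&4 =' &3)))) ⊓
  (∀' ∀' (labelFormula 0 0 ⟹ labelFormula 0 1 ⟹ ∼(edgeFormula 0 (1 : Fin 2)))) ⊓
  (∀' ∀' ∀' ∀' ∀' ∀' (gadgetFormula 0 1 2 3 ⟹ gadgetFormula 0 4 5 3 ⟹ (&1 =' &4))) ⊓
  (∀' ∼(representsFormula 0 (0 : Fin 1))) ⊓
  (∀' ∀' ∀' (representsFormula 0 1 ⟹ representsFormula 1 2 ⟹ representsFormula 0 (2 : Fin 3))) ⊓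
  (∀' ∀' (labelFormula 0 0 ⟹ labelFormula 0 1 ⟹ ∼(&0 =' &1) ⟹
    representsFormula 0 1 ⊔ representsFormula 1 (0 : Fin 2)))

theorem models_gadLinSentence {G : LabelledGraph 3 V} : G.Models gadLinSentence ↔ G.IsGadLin := by
  simp only [Models, Sentence.Realize, Formula.Realize, gadLinSentence, BoundedFormula.realize_inf,
    BoundedFormula.realize_sup, BoundedFormula.realize_not, BoundedFormula.realize_imp,
    BoundedFormula.realize_all, BoundedFormula.realize_ex, BoundedFormula.realize_bdEqual,
    realize_oneHotFormula G, realize_labelFormula G, realize_edgeFormula G,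
    realize_gadgetFormula G, realize_representsFormula G, and_assoc]
  exact ⟨fun ⟨h₁, h₂, h₃, h₄, h₅, h₆, h₇, h₈, h₉, h₁₀⟩ =>
      ⟨h₁, h₂, h₃, h₄, h₅, h₆, h₇, h₈, h₉, h₁₀⟩,
    fun ⟨h₁, h₂, h₃, h₄, h₅, h₆, h₇, h₈, h₉, h₁₀⟩ =>
      ⟨h₁, h₂, h₃, h₄, h₅, h₆, h₇, h₈, h₉, h₁₀⟩⟩

theorem LabelledGraph.IsIso.isGadLin_iff {G : LabelledGraph 3 V} {H : LabelledGraph 3 W}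
    (h : G.IsIso H) : G.IsGadLin ↔ H.IsGadLin := by
  rw [← models_gadLinSentence, ← models_gadLinSentence, h.models_iff]

end Formulas

/-! ### Gadgetisations with redirected gadgets -/

section Redirect

variable {d : ℕ} {V : Type} {D : LabelledDigraph d V} {τ : V → V → V}

/-- The edges of a gadgetisation, each listed in one direction, in which the gadget of `(u, w)`
ends at `τ u w` instead of `w`. -/
inductive RedirectEdge (D : LabelledDigraph d V) (τ : V → V → V) : GadNode D → GadNode D → Prop
  | first (u w : V) (h : D.edge u w) : RedirectEdge D τ (.one u) (.two u w h)
  | second (u w : V) (h : D.edge u w) : RedirectEdge D τ (.two u w h) (.three u w h)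
  | third (u w : V) (h : D.edge u w) : RedirectEdge D τ (.three u w h) (.one (τ u w))

/-- The gadgetisation of a directed graph in which the gadget of `(u, w)` ends at `τ u w` instead
of `w`. -/
def redirect (D : LabelledDigraph d V) (τ : V → V → V) : LabelledGraph 3 (GadNode D) where
  Adj x y := RedirectEdge D τ x y ∨ RedirectEdge D τ y x
  symm := ⟨fun _ _ h => h.symm⟩
  loopless := ⟨fun x h => by rcases h with h | h <;> cases h⟩
  label := (gad D).label

theorem redirect_adj_one {u : V} {y : GadNode D} :
    (redirect D τ).Adj (.one u) y ↔
      (∃ w h, y = .two u w h) ∨ ∃ v w h, y = .three v w h ∧ τ v w = u := by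
  constructor
  · rintro (h | h) <;> cases h
    · exact .inl ⟨_, _, rfl⟩
    · exact .inr ⟨_, _, _, rfl, rfl⟩
  · rintro (⟨w, h, rfl⟩ | ⟨v, w, h, rfl, rfl⟩)
    · exact .inl (.first _ _ _)
    · exact .inr (.third _ _ _)

theorem redirect_adj_two {u w : V} {h : D.edge u w} {y : GadNode D} :
    (redirect D τ).Adj (.two u w h) y ↔ y = .one u ∨ y = .three u w h := by
  constructor
  · rintro (h | h) <;> cases h
    · exact .inr rfl
    · exact .inl rfl
  · rintro (rfl | rfl)
    · exact .inr (.first _ _ _)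
    · exact .inl (.second _ _ _)

theorem redirect_adj_three {u w : V} {h : D.edge u w} {y : GadNode D} :
    (redirect D τ).Adj (.three u w h) y ↔ y = .two u w h ∨ y = .one (τ u w) := by
  constructor
  · rintro (h | h) <;> cases h
    · exact .inr rfl
    · exact .inl rfl
  · rintro (rfl | rfl)
    · exact .inr (.second _ _ _)
    · exact .inl (.third _ _ _)

theorem redirectEdge_snd_iff {x y : GadNode D} :
    RedirectEdge D (fun _ w => w) x y ↔ GadEdge D x y := by
  constructor <;> rintro (⟨u, w, h⟩ | ⟨u, w, h⟩ | ⟨u, w, h⟩) <;> constructor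

theorem redirect_snd_eq_gad : redirect D (fun _ w => w) = gad D := by
  have adj_eq : (redirect D fun _ w => w).toSimpleGraph = (gad D).toSimpleGraph := by
    ext x y
    exact or_congr redirectEdge_snd_iff redirectEdge_snd_iff
  exact congrArg (LabelledGraph.mk · (gad D).label) adj_eq

end Redirect

section Gad

variable {d : ℕ} {V : Type} {D : LabelledDigraph d V}

theorem gad_adj_two {u w : V} {h : D.edge u w} {y : GadNode D} :
    (gad D).Adj (.two u w h) y ↔ y = .one u ∨ y = .three u w h := by
  rw [← redirect_snd_eq_gad, redirect_adj_two]

theorem gad_adj_three {u w : V} {h : D.edge u w} {y : GadNode D} :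
    (gad D).Adj (.three u w h) y ↔ y = .two u w h ∨ y = .one w := by
  rw [← redirect_snd_eq_gad, redirect_adj_three]

theorem gad_label_zero {x : GadNode D} : (gad D).label x 0 = true ↔ ∃ u, x = .one u := by
  cases x <;> simp [gad]

theorem gad_label_one {x : GadNode D} : (gad D).label x 1 = true ↔ ∃ u w h, x = .two u w h := by
  cases x <;> simp [gad, *]

theorem gad_label_two {x : GadNode D} : (gad D).label x 2 = true ↔ ∃ u w h, x = .three u w h := by
  cases x <;> simp [gad, *]

theorem isOneHot_gad_label (x : GadNode D) : IsOneHot ((gad D).label x) := by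
  rcases x with _ | _ | _
  · exact ⟨0, by simp [gad, Fin.forall_fin_succ]⟩
  · exact ⟨1, by simp [gad, Fin.forall_fin_succ]⟩
  · exact ⟨2, by simp [gad, Fin.forall_fin_succ]⟩

theorem isGadget_gad {u w : V} (h : D.edge u w) :
    (gad D).IsGadget (.one u) (.two u w h) (.three u w h) (.one w) :=
  ⟨rfl, rfl, rfl, rfl, .inl (.first u w h), .inl (.second u w h), .inl (.third u w h)⟩

theorem isGadget_gad_iff {x a b y : GadNode D} :
    (gad D).IsGadget x a b y ↔
      ∃ u w h, x = .one u ∧ a = .two u w h ∧ b = .three u w h ∧ y = .one w := by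
  constructor
  · rintro ⟨hx, ha, hb, hy, hxa, hab, hby⟩
    obtain ⟨_, rfl⟩ := gad_label_zero.1 hx
    obtain ⟨u, w, h, rfl⟩ := gad_label_one.1 ha
    obtain ⟨_, rfl⟩ := gad_label_zero.1 hy
    cases (gad_adj_two.1 hxa.symm).resolve_right nofun
    obtain rfl := (gad_adj_two.1 hab).resolve_left (by rintro rfl; simp [gad] at hb)
    cases (gad_adj_three.1 hby).resolve_left nofun
    exact ⟨_, _, h, rfl, rfl, rfl, rfl⟩
  · rintro ⟨u, w, h, rfl, rfl, rfl, rfl⟩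
    exact isGadget_gad h

theorem represents_gad_iff {x y : GadNode D} :
    (gad D).Represents x y ↔ ∃ u w, D.edge u w ∧ x = .one u ∧ y = .one w := by
  constructor
  · rintro ⟨a, b, hg⟩
    obtain ⟨u, w, h, rfl, -, -, rfl⟩ := isGadget_gad_iff.1 hg
    exact ⟨u, w, h, rfl, rfl⟩
  · rintro ⟨u, w, h, rfl, rfl⟩
    exact ⟨_, _, isGadget_gad h⟩

theorem represents_gad_trans (hD : IsStrictTotalOrder V D.edge) {x y z : GadNode D}
    (hxy : (gad D).Represents x y) (hyz : (gad D).Represents y z) : (gad D).Represents x z := by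
  obtain ⟨u, v, huv, rfl, rfl⟩ := represents_gad_iff.1 hxy
  obtain ⟨_, w, hvw, hv, rfl⟩ := represents_gad_iff.1 hyz
  cases hv
  exact represents_gad_iff.2 ⟨u, w, hD.trans _ _ _ huv hvw, rfl, rfl⟩

theorem represents_gad_total (hD : IsStrictTotalOrder V D.edge) {x y : GadNode D}
    (hx : (gad D).label x 0 = true) (hy : (gad D).label y 0 = true) (hne : x ≠ y) :
    (gad D).Represents x y ∨ (gad D).Represents y x := by
  obtain ⟨u, rfl⟩ := gad_label_zero.1 hx
  obtain ⟨w, rfl⟩ := gad_label_zero.1 hy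
  rcases trichotomous_of D.edge u w with h | rfl | h
  · exact .inl (represents_gad_iff.2 ⟨u, w, h, rfl, rfl⟩)
  · exact absurd rfl hne
  · exact .inr (represents_gad_iff.2 ⟨w, u, h, rfl, rfl⟩)

theorem isGadLin_gad (hD : IsStrictTotalOrder V D.edge) : (gad D).IsGadLin where
  isOneHot := isOneHot_gad_label
  exists_isGadget_of_two a ha := by
    obtain ⟨u, w, h, rfl⟩ := gad_label_one.1 ha
    exact ⟨_, _, _, isGadget_gad h⟩
  exists_isGadget_of_three b hb := by
    obtain ⟨u, w, h, rfl⟩ := gad_label_two.1 hb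
    exact ⟨_, _, _, isGadget_gad h⟩
  adj_two x a b y hg z hz := by
    obtain ⟨u, w, h, rfl, rfl, rfl, rfl⟩ := isGadget_gad_iff.1 hg
    exact gad_adj_two.1 hz
  adj_three x a b y hg z hz := by
    obtain ⟨u, w, h, rfl, rfl, rfl, rfl⟩ := isGadget_gad_iff.1 hg
    exact gad_adj_three.1 hz
  not_adj_one x y hx hy hxy := by
    obtain ⟨u, rfl⟩ := gad_label_zero.1 hx
    obtain ⟨w, rfl⟩ := gad_label_zero.1 hy
    rcases hxy with h | h <;> cases h
  two_unique x a b y a' b' hg hg' := by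
    obtain ⟨u, w, h, rfl, rfl, rfl, rfl⟩ := isGadget_gad_iff.1 hg
    obtain ⟨_, _, _, hu, rfl, rfl, hw⟩ := isGadget_gad_iff.1 hg'
    cases hu
    cases hw
    rfl
  irrefl x hx := by
    obtain ⟨u, w, h, rfl, hw⟩ := represents_gad_iff.1 hx
    cases hw
    exact D.irrefl _ h
  trans _ _ _ := represents_gad_trans hD
  total _ _ := represents_gad_total hD

end Gad

namespace LabelledGraph.IsGadLin

variable {V : Type} {G : LabelledGraph 3 V} {u a b w u' a' b' w' : V}

theorem ne_of_label (hG : G.IsGadLin) {x y : V} {i j : Fin 3} (hx : G.label x i = true)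
    (hy : G.label y j = true) (hij : i ≠ j) : x ≠ y := by
  rintro rfl
  exact hij ((hG.isOneHot x).eq_of_eq_true hx hy)

theorem eq_source (hG : G.IsGadLin) (h : G.IsGadget u a b w) {x : V} (hx : G.label x 0 = true)
    (hax : G.Adj a x) : x = u :=
  (hG.adj_two _ _ _ _ h x hax).resolve_right (hG.ne_of_label hx h.label_three (by decide))

theorem eq_three (hG : G.IsGadLin) (h : G.IsGadget u a b w) {x : V} (hx : G.label x 2 = true)
    (hax : G.Adj a x) : x = b :=
  (hG.adj_two _ _ _ _ h x hax).resolve_left (hG.ne_of_label hx h.label_source (by decide))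

theorem eq_two (hG : G.IsGadLin) (h : G.IsGadget u a b w) {x : V} (hx : G.label x 1 = true)
    (hbx : G.Adj b x) : x = a :=
  (hG.adj_three _ _ _ _ h x hbx).resolve_right (hG.ne_of_label hx h.label_target (by decide))

theorem eq_target (hG : G.IsGadLin) (h : G.IsGadget u a b w) {x : V} (hx : G.label x 0 = true)
    (hbx : G.Adj b x) : x = w :=
  (hG.adj_three _ _ _ _ h x hbx).resolve_left (hG.ne_of_label hx h.label_two (by decide))

theorem isGadget_eq_of_two (hG : G.IsGadLin) (h : G.IsGadget u a b w)
    (h' : G.IsGadget u' a b' w') : u' = u ∧ b' = b ∧ w' = w := by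
  obtain rfl := hG.eq_three h h'.label_three h'.adj_two_three
  exact ⟨hG.eq_source h h'.label_source h'.adj_source.symm, rfl,
    hG.eq_target h h'.label_target h'.adj_target⟩

theorem isGadget_eq_of_three (hG : G.IsGadLin) (h : G.IsGadget u a b w)
    (h' : G.IsGadget u' a' b w') : u' = u ∧ a' = a ∧ w' = w := by
  obtain rfl := hG.eq_two h h'.label_two h'.adj_two_three.symm
  obtain ⟨hu, -, hw⟩ := hG.isGadget_eq_of_two h h'
  exact ⟨hu, rfl, hw⟩

theorem three_unique (hG : G.IsGadLin) (h : G.IsGadget u a b w) (h' : G.IsGadget u a' b' w) :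
    b = b' := by
  obtain rfl := hG.two_unique _ _ _ _ _ _ h h'
  exact (hG.isGadget_eq_of_two h' h).2.1

/-- The strict linear order, on the nodes labelled `(1,0,0)`, that is represented by the gadgets of
a graph. -/
def digraph (hG : G.IsGadLin) : LabelledDigraph 0 {v // G.label v 0 = true} where
  edge u w := G.Represents u w
  irrefl u := hG.irrefl u
  label _ i := i.elim0

theorem isStrictTotalOrder_digraph (hG : G.IsGadLin) :
    IsStrictTotalOrder _ hG.digraph.edge where
  irrefl := hG.digraph.irrefl
  trans u v w := hG.trans u v w
  trichotomous u w h h' := by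
    by_contra hne
    exact (hG.total u w u.2 w.2 (Subtype.coe_ne_coe.2 hne)).elim h h'

/-- The node of the graph that corresponds to a node of the gadgetisation. -/
noncomputable def ofGadNode (hG : G.IsGadLin) : GadNode hG.digraph → V
  | .one u => u
  | .two _ _ h => h.choose
  | .three _ _ h => h.choose_spec.choose

theorem isGadget_ofGadNode (hG : G.IsGadLin) {u w : {v // G.label v 0 = true}}
    (h : hG.digraph.edge u w) :
    G.IsGadget u (hG.ofGadNode (.two u w h)) (hG.ofGadNode (.three u w h)) w :=
  h.choose_spec.choose_spec

theorem label_ofGadNode (hG : G.IsGadLin) (x : GadNode hG.digraph) :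
    G.label (hG.ofGadNode x) = (gad hG.digraph).label x := by
  rcases x with u | ⟨u, w, h⟩ | ⟨u, w, h⟩
  · exact (hG.isOneHot _).ext (isOneHot_gad_label _) u.2 rfl
  · exact (hG.isOneHot _).ext (isOneHot_gad_label _) (hG.isGadget_ofGadNode h).label_two rfl
  · exact (hG.isOneHot _).ext (isOneHot_gad_label _) (hG.isGadget_ofGadNode h).label_three rfl

theorem ofGadNode_injective (hG : G.IsGadLin) : Function.Injective hG.ofGadNode := by
  intro x y hxy
  have label_eq : (gad hG.digraph).label x = (gad hG.digraph).label y := by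
    rw [← label_ofGadNode, ← label_ofGadNode, hxy]
  rcases x with u | ⟨u, w, h⟩ | ⟨u, w, h⟩ <;> rcases y with u' | ⟨u', w', h'⟩ | ⟨u', w', h'⟩ <;>
    simp only [gad, Matrix.vecCons_inj, reduceCtorEq, and_false, false_and] at label_eq
  · exact congrArg _ (Subtype.ext hxy)
  · have hg := hG.isGadget_ofGadNode h
    rw [hxy] at hg
    obtain ⟨hu, -, hw⟩ := hG.isGadget_eq_of_two (hG.isGadget_ofGadNode h') hg
    obtain rfl := Subtype.ext hu
    obtain rfl := Subtype.ext hw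
    rfl
  · have hg := hG.isGadget_ofGadNode h
    rw [hxy] at hg
    obtain ⟨hu, -, hw⟩ := hG.isGadget_eq_of_three (hG.isGadget_ofGadNode h') hg
    obtain rfl := Subtype.ext hu
    obtain rfl := Subtype.ext hw
    rfl

theorem ofGadNode_surjective (hG : G.IsGadLin) : Function.Surjective hG.ofGadNode := by
  intro v
  obtain ⟨i, hi⟩ := hG.isOneHot v
  have hv := (hi i).2 rfl
  fin_cases i
  · exact ⟨.one ⟨v, hv⟩, rfl⟩
  · obtain ⟨u, b, w, hg⟩ := hG.exists_isGadget_of_two v hv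
    let e : hG.digraph.edge ⟨u, hg.label_source⟩ ⟨w, hg.label_target⟩ := ⟨v, b, hg⟩
    exact ⟨.two _ _ e, hG.two_unique _ _ _ _ _ _ (hG.isGadget_ofGadNode e) hg⟩
  · obtain ⟨u, a, w, hg⟩ := hG.exists_isGadget_of_three v hv
    let e : hG.digraph.edge ⟨u, hg.label_source⟩ ⟨w, hg.label_target⟩ := ⟨a, v, hg⟩
    exact ⟨.three _ _ e, hG.three_unique (hG.isGadget_ofGadNode e) hg⟩

theorem adj_ofGadNode_of_gadEdge (hG : G.IsGadLin) {x y : GadNode hG.digraph}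
    (h : GadEdge hG.digraph x y) : G.Adj (hG.ofGadNode x) (hG.ofGadNode y) := by
  rcases h with ⟨u, w, h⟩ | ⟨u, w, h⟩ | ⟨u, w, h⟩
  · exact (hG.isGadget_ofGadNode h).adj_source
  · exact (hG.isGadget_ofGadNode h).adj_two_three
  · exact (hG.isGadget_ofGadNode h).adj_target

theorem gad_adj_two_of_adj_ofGadNode (hG : G.IsGadLin) {u w : {v // G.label v 0 = true}}
    {h : hG.digraph.edge u w} {y : GadNode hG.digraph}
    (hy : G.Adj (hG.ofGadNode (.two u w h)) (hG.ofGadNode y)) :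
    (gad hG.digraph).Adj (.two u w h) y :=
  gad_adj_two.2 <| (hG.adj_two _ _ _ _ (hG.isGadget_ofGadNode h) _ hy).imp
    (fun e => hG.ofGadNode_injective e) fun e => hG.ofGadNode_injective e

theorem gad_adj_three_of_adj_ofGadNode (hG : G.IsGadLin) {u w : {v // G.label v 0 = true}}
    {h : hG.digraph.edge u w} {y : GadNode hG.digraph}
    (hy : G.Adj (hG.ofGadNode (.three u w h)) (hG.ofGadNode y)) :
    (gad hG.digraph).Adj (.three u w h) y :=
  gad_adj_three.2 <| (hG.adj_three _ _ _ _ (hG.isGadget_ofGadNode h) _ hy).imp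
    (fun e => hG.ofGadNode_injective e) fun e => hG.ofGadNode_injective e

theorem adj_ofGadNode (hG : G.IsGadLin) {x y : GadNode hG.digraph} :
    G.Adj (hG.ofGadNode x) (hG.ofGadNode y) ↔ (gad hG.digraph).Adj x y := by
  refine ⟨fun hxy => ?_, Or.rec hG.adj_ofGadNode_of_gadEdge fun h =>
    (hG.adj_ofGadNode_of_gadEdge h).symm⟩
  rcases x with u | _ | _
  · rcases y with w | _ | _
    · exact absurd hxy (hG.not_adj_one _ _ u.2 w.2)
    · exact (hG.gad_adj_two_of_adj_ofGadNode hxy.symm).symm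
    · exact (hG.gad_adj_three_of_adj_ofGadNode hxy.symm).symm
  · exact hG.gad_adj_two_of_adj_ofGadNode hxy
  · exact hG.gad_adj_three_of_adj_ofGadNode hxy

theorem isIso_gad (hG : G.IsGadLin) : G.IsIso (gad hG.digraph) := by
  let f : (gad hG.digraph).toSimpleGraph ≃g G.toSimpleGraph :=
    { Equiv.ofBijective _ ⟨hG.ofGadNode_injective, hG.ofGadNode_surjective⟩ with
      map_rel_iff' := hG.adj_ofGadNode }
  refine ⟨f.symm, fun v => ?_⟩
  obtain ⟨x, rfl⟩ := f.surjective v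
  rw [f.symm_apply_apply]
  exact (hG.label_ofGadNode x).symm

end LabelledGraph.IsGadLin

theorem gadLin_iff {V : Type} [Fintype V] {G : LabelledGraph 3 V} {v : V} :
    gadLin V G v ↔ G.IsGadLin :=
  ⟨fun ⟨_, _, _, _, hD, h⟩ => h.isGadLin_iff.2 (isGadLin_gad hD),
    fun h => ⟨0, _, inferInstance, _, h.isStrictTotalOrder_digraph, h.isIso_gad⟩⟩

theorem foExpressible_gadLin : FOExpressible gadLin :=
  foExpressible_of_sentence gadLinSentence fun _ _ _ _ =>
    models_gadLinSentence.trans gadLin_iff.symm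

/-! ### Out-degrees in gadgetised linear orders -/

namespace LabelledGraph

section Degrees

variable {V : Type} [Fintype V]

/-- In a gadgetisation, the number of successors of a node of the directed graph. -/
noncomputable def outDegree (G : LabelledGraph 3 V) (v : V) : ℕ := (G.labelNbrs 1 v).card

/-- In a gadgetisation, the out-degree of the target of the gadget of a node labelled
`(0,0,1)`. -/
noncomputable def threeDegree (G : LabelledGraph 3 V) (v : V) : ℕ :=
  ((G.labelNbrs 0 v).val.map G.outDegree).sum

/-- In a gadgetisation, the out-degree of the target of the gadget of a node labelled
`(0,1,0)`. -/
noncomputable def twoDegree (G : LabelledGraph 3 V) (v : V) : ℕ :=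
  ((G.labelNbrs 2 v).val.map G.threeDegree).sum

/-- The condition that membership in a gadgetisation imposes on the label `l` of a node and the
numbers `c i` of its neighbours of label `i`. -/
structure LocalCondition (l : Fin 3 → Bool) (c : Fin 3 → ℕ) : Prop where
  isOneHot : IsOneHot l
  one : l 0 = true → c 0 = 0
  two : l 1 = true → c = ![1, 0, 1]
  three : l 2 = true → c = ![1, 1, 0]

/-- The characterisation of gadgetised strict linear orders that an ACR-GNN can check: the
out-degrees are pairwise distinct, and the successors of a node of out-degree `m` have the
out-degrees `0, …, m - 1`. -/
structure DegreeCondition (G : LabelledGraph 3 V) : Prop where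
  localCond : ∀ v, LocalCondition (G.label v) fun i => (G.labelNbrs i v).card
  map_twoDegree : ∀ v, G.label v 0 = true →
    (G.labelNbrs 1 v).val.map G.twoDegree = Multiset.range (G.outDegree v)
  injOn : Set.InjOn G.outDegree {v | G.label v 0 = true}

variable {G : LabelledGraph 3 V} {u a b w : V}

theorem IsGadget.mem_labelNbrs_one (h : G.IsGadget u a b w) : a ∈ G.labelNbrs 1 u :=
  mem_labelNbrs.2 ⟨h.adj_source, h.label_two⟩

theorem twoDegree_eq_outDegree (ha : (G.labelNbrs · a) = ![{u}, ∅, {b}])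
    (hb : (G.labelNbrs · b) = ![{w}, {a}, ∅]) : G.twoDegree a = G.outDegree w := by
  have hab : G.labelNbrs 2 a = {b} := congrFun ha 2
  have hbw : G.labelNbrs 0 b = {w} := congrFun hb 0
  simp [twoDegree, threeDegree, hab, hbw]

end Degrees

namespace DegreeCondition

variable {V : Type} [Fintype V] {G : LabelledGraph 3 V} {u a b w a' b' : V}

theorem exists_labelNbrs_two (hG : G.DegreeCondition) (ha : G.label a 1 = true) :
    ∃ u b, (G.labelNbrs · a) = ![{u}, ∅, {b}] := by
  have card := congrFun ((hG.localCond a).two ha)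
  obtain ⟨u, hu⟩ := Finset.card_eq_one.1 (card 0)
  obtain ⟨b, hb⟩ := Finset.card_eq_one.1 (card 2)
  refine ⟨u, b, funext fun i => ?_⟩
  fin_cases i
  exacts [hu, Finset.card_eq_zero.1 (card 1), hb]

theorem exists_labelNbrs_three (hG : G.DegreeCondition) (hb : G.label b 2 = true) :
    ∃ w a, (G.labelNbrs · b) = ![{w}, {a}, ∅] := by
  have card := congrFun ((hG.localCond b).three hb)
  obtain ⟨w, hw⟩ := Finset.card_eq_one.1 (card 0)
  obtain ⟨a, ha⟩ := Finset.card_eq_one.1 (card 1)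
  refine ⟨w, a, funext fun i => ?_⟩
  fin_cases i
  exacts [hw, ha, Finset.card_eq_zero.1 (card 2)]

theorem labelNbrs_two (hG : G.DegreeCondition) (h : G.IsGadget u a b w) :
    (G.labelNbrs · a) = ![{u}, ∅, {b}] := by
  obtain ⟨u', b', nbrs⟩ := hG.exists_labelNbrs_two h.label_two
  have nbrs_zero : G.labelNbrs 0 a = {u'} := congrFun nbrs 0
  have nbrs_two : G.labelNbrs 2 a = {b'} := congrFun nbrs 2
  obtain rfl : u = u' :=
    Finset.mem_singleton.1 (nbrs_zero ▸ mem_labelNbrs.2 ⟨h.adj_source.symm, h.label_source⟩)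
  obtain rfl : b = b' :=
    Finset.mem_singleton.1 (nbrs_two ▸ mem_labelNbrs.2 ⟨h.adj_two_three, h.label_three⟩)
  exact nbrs

theorem labelNbrs_three (hG : G.DegreeCondition) (h : G.IsGadget u a b w) :
    (G.labelNbrs · b) = ![{w}, {a}, ∅] := by
  obtain ⟨w', a', nbrs⟩ := hG.exists_labelNbrs_three h.label_three
  have nbrs_zero : G.labelNbrs 0 b = {w'} := congrFun nbrs 0
  have nbrs_one : G.labelNbrs 1 b = {a'} := congrFun nbrs 1
  obtain rfl : w = w' :=
    Finset.mem_singleton.1 (nbrs_zero ▸ mem_labelNbrs.2 ⟨h.adj_target, h.label_target⟩)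
  obtain rfl : a = a' :=
    Finset.mem_singleton.1 (nbrs_one ▸ mem_labelNbrs.2 ⟨h.adj_two_three.symm, h.label_two⟩)
  exact nbrs

theorem exists_isGadget_of_two (hG : G.DegreeCondition) (ha : G.label a 1 = true) :
    ∃ u b w, G.IsGadget u a b w := by
  obtain ⟨u, b, nbrs_a⟩ := hG.exists_labelNbrs_two ha
  have hu : u ∈ G.labelNbrs 0 a := congrFun nbrs_a 0 ▸ Finset.mem_singleton_self u
  have hb : b ∈ G.labelNbrs 2 a := congrFun nbrs_a 2 ▸ Finset.mem_singleton_self b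
  rw [mem_labelNbrs] at hu hb
  obtain ⟨w, _, nbrs_b⟩ := hG.exists_labelNbrs_three hb.2
  have hw : w ∈ G.labelNbrs 0 b := congrFun nbrs_b 0 ▸ Finset.mem_singleton_self w
  rw [mem_labelNbrs] at hw
  exact ⟨u, b, w, hu.2, ha, hb.2, hw.2, hu.1.symm, hb.1, hw.1⟩

theorem exists_isGadget_of_three (hG : G.DegreeCondition) (hb : G.label b 2 = true) :
    ∃ u a w, G.IsGadget u a b w := by
  obtain ⟨_, a, nbrs_b⟩ := hG.exists_labelNbrs_three hb
  have ha : a ∈ G.labelNbrs 1 b := congrFun nbrs_b 1 ▸ Finset.mem_singleton_self a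
  rw [mem_labelNbrs] at ha
  obtain ⟨u, b', w, hg⟩ := hG.exists_isGadget_of_two ha.2
  have nbrs_a : G.labelNbrs 2 a = {b'} := congrFun (hG.labelNbrs_two hg) 2
  obtain rfl : b = b' := Finset.mem_singleton.1 (nbrs_a ▸ mem_labelNbrs.2 ⟨ha.1.symm, hb⟩)
  exact ⟨u, a, w, hg⟩

theorem mem_labelNbrs_of_adj (hG : G.DegreeCondition) {v x : V} (h : G.Adj v x) :
    ∃ i, x ∈ (G.labelNbrs · v) i := by
  obtain ⟨i, hi⟩ := (hG.localCond x).isOneHot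
  exact ⟨i, mem_labelNbrs.2 ⟨h, (hi i).2 rfl⟩⟩

theorem adj_two (hG : G.DegreeCondition) (h : G.IsGadget u a b w) {x : V} (hx : G.Adj a x) :
    x = u ∨ x = b := by
  obtain ⟨i, hi⟩ := hG.mem_labelNbrs_of_adj hx
  rw [hG.labelNbrs_two h] at hi
  fin_cases i
  exacts [.inl (Finset.mem_singleton.1 hi), absurd hi (Finset.notMem_empty x),
    .inr (Finset.mem_singleton.1 hi)]

theorem adj_three (hG : G.DegreeCondition) (h : G.IsGadget u a b w) {x : V} (hx : G.Adj b x) :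
    x = a ∨ x = w := by
  obtain ⟨i, hi⟩ := hG.mem_labelNbrs_of_adj hx
  rw [hG.labelNbrs_three h] at hi
  fin_cases i
  exacts [.inr (Finset.mem_singleton.1 hi), .inl (Finset.mem_singleton.1 hi),
    absurd hi (Finset.notMem_empty x)]

theorem not_adj_one (hG : G.DegreeCondition) (hu : G.label u 0 = true) (hw : G.label w 0 = true) :
    ¬ G.Adj u w := fun h =>
  Finset.notMem_empty w (Finset.card_eq_zero.1 ((hG.localCond u).one hu) ▸
    mem_labelNbrs.2 ⟨h, hw⟩)

theorem twoDegree_eq (hG : G.DegreeCondition) (h : G.IsGadget u a b w) :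
    G.twoDegree a = G.outDegree w :=
  twoDegree_eq_outDegree (hG.labelNbrs_two h) (hG.labelNbrs_three h)

theorem two_unique (hG : G.DegreeCondition) (h : G.IsGadget u a b w)
    (h' : G.IsGadget u a' b' w) : a = a' := by
  have nodup : ((G.labelNbrs 1 u).val.map G.twoDegree).Nodup := by
    rw [hG.map_twoDegree u h.label_source]
    exact Multiset.nodup_range _
  exact Multiset.inj_on_of_nodup_map nodup a h.mem_labelNbrs_one a' h'.mem_labelNbrs_one
    (by rw [hG.twoDegree_eq h, hG.twoDegree_eq h'])

theorem represents_iff (hG : G.DegreeCondition) :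
    G.Represents u w ↔
      G.label u 0 = true ∧ G.label w 0 = true ∧ G.outDegree w < G.outDegree u := by
  constructor
  · rintro ⟨a, b, h⟩
    refine ⟨h.label_source, h.label_target, ?_⟩
    rw [← Multiset.mem_range, ← hG.map_twoDegree u h.label_source, ← hG.twoDegree_eq h]
    exact Multiset.mem_map_of_mem _ h.mem_labelNbrs_one
  · rintro ⟨hu, hw, hlt⟩
    rw [← Multiset.mem_range, ← hG.map_twoDegree u hu, Multiset.mem_map] at hlt
    obtain ⟨a, ha, degree_eq⟩ := hlt
    obtain ⟨hua, ha⟩ := mem_labelNbrs.1 ha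
    obtain ⟨u', b, w', h⟩ := hG.exists_isGadget_of_two ha
    obtain rfl : u = u' :=
      (hG.adj_two h hua.symm).resolve_right (by
        rintro rfl
        exact absurd ((hG.localCond u).isOneHot.eq_of_eq_true hu h.label_three) (by decide))
    obtain rfl : w' = w := hG.injOn h.label_target hw (by rw [← hG.twoDegree_eq h, degree_eq])
    exact ⟨a, b, h⟩

theorem isGadLin (hG : G.DegreeCondition) : G.IsGadLin where
  isOneHot v := (hG.localCond v).isOneHot
  exists_isGadget_of_two _ := hG.exists_isGadget_of_two
  exists_isGadget_of_three _ := hG.exists_isGadget_of_three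
  adj_two _ _ _ _ h _ := hG.adj_two h
  adj_three _ _ _ _ h _ := hG.adj_three h
  not_adj_one _ _ := hG.not_adj_one
  two_unique _ _ _ _ _ _ := hG.two_unique
  irrefl u h := (hG.represents_iff.1 h).2.2.false
  trans u w x h h' := by
    rw [hG.represents_iff] at h h' ⊢
    exact ⟨h.1, h'.2.1, h'.2.2.trans h.2.2⟩
  total u w hu hw hne := by
    rcases lt_trichotomy (G.outDegree u) (G.outDegree w) with h | h | h
    · exact .inr (hG.represents_iff.2 ⟨hw, hu, h⟩)
    · exact absurd (hG.injOn hu hw h) hne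
    · exact .inl (hG.represents_iff.2 ⟨hu, hw, h⟩)

end DegreeCondition

namespace IsGadLin

variable {V : Type} [Fintype V] {G : LabelledGraph 3 V} {u a b w : V}

theorem labelNbrs_two (hG : G.IsGadLin) (h : G.IsGadget u a b w) :
    (G.labelNbrs · a) = ![{u}, ∅, {b}] := by
  funext i
  ext x
  rw [mem_labelNbrs]
  fin_cases i
  · refine ⟨fun hx => Finset.mem_singleton.2 (hG.eq_source h hx.2 hx.1), fun hx => ?_⟩
    obtain rfl := Finset.mem_singleton.1 hx
    exact ⟨h.adj_source.symm, h.label_source⟩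
  · refine ⟨fun hx => (hG.adj_two _ _ _ _ h x hx.1).elim (fun e => ?_) fun e => ?_,
      fun hx => absurd hx (Finset.notMem_empty x)⟩
    · exact absurd e (hG.ne_of_label hx.2 h.label_source (by decide))
    · exact absurd e (hG.ne_of_label hx.2 h.label_three (by decide))
  · refine ⟨fun hx => Finset.mem_singleton.2 (hG.eq_three h hx.2 hx.1), fun hx => ?_⟩
    obtain rfl := Finset.mem_singleton.1 hx
    exact ⟨h.adj_two_three, h.label_three⟩

theorem labelNbrs_three (hG : G.IsGadLin) (h : G.IsGadget u a b w) :
    (G.labelNbrs · b) = ![{w}, {a}, ∅] := by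
  funext i
  ext x
  rw [mem_labelNbrs]
  fin_cases i
  · refine ⟨fun hx => Finset.mem_singleton.2 (hG.eq_target h hx.2 hx.1), fun hx => ?_⟩
    obtain rfl := Finset.mem_singleton.1 hx
    exact ⟨h.adj_target, h.label_target⟩
  · refine ⟨fun hx => Finset.mem_singleton.2 (hG.eq_two h hx.2 hx.1), fun hx => ?_⟩
    obtain rfl := Finset.mem_singleton.1 hx
    exact ⟨h.adj_two_three.symm, h.label_two⟩
  · refine ⟨fun hx => (hG.adj_three _ _ _ _ h x hx.1).elim (fun e => ?_) fun e => ?_,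
      fun hx => absurd hx (Finset.notMem_empty x)⟩
    · exact absurd e (hG.ne_of_label hx.2 h.label_two (by decide))
    · exact absurd e (hG.ne_of_label hx.2 h.label_target (by decide))

theorem localCondition (hG : G.IsGadLin) (v : V) :
    LocalCondition (G.label v) fun i => (G.labelNbrs i v).card where
  isOneHot := hG.isOneHot v
  one hv := by
    refine Finset.card_eq_zero.2 (Finset.eq_empty_of_forall_notMem fun x hx => ?_)
    rw [mem_labelNbrs] at hx
    exact hG.not_adj_one v x hv hx.2 hx.1
  two hv := by
    obtain ⟨u, b, w, h⟩ := hG.exists_isGadget_of_two v hv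
    funext i
    rw [congrFun (hG.labelNbrs_two h) i]
    fin_cases i <;> rfl
  three hv := by
    obtain ⟨u, a, w, h⟩ := hG.exists_isGadget_of_three v hv
    funext i
    rw [congrFun (hG.labelNbrs_three h) i]
    fin_cases i <;> rfl

theorem exists_isGadget (hG : G.IsGadLin) (hu : G.label u 0 = true)
    (ha : a ∈ G.labelNbrs 1 u) : ∃ w b, G.IsGadget u a b w := by
  obtain ⟨hua, ha⟩ := mem_labelNbrs.1 ha
  obtain ⟨u', b, w, h⟩ := hG.exists_isGadget_of_two a ha
  obtain rfl := hG.eq_source h hu hua.symm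
  exact ⟨w, b, h⟩

theorem twoDegree_eq (hG : G.IsGadLin) (h : G.IsGadget u a b w) :
    G.twoDegree a = G.outDegree w :=
  twoDegree_eq_outDegree (hG.labelNbrs_two h) (hG.labelNbrs_three h)

open Classical in
theorem outDegree_eq_card_represents (hG : G.IsGadLin) (hu : G.label u 0 = true) :
    G.outDegree u = ({w | G.Represents u w} : Finset V).card := by
  have target a (ha : a ∈ G.labelNbrs 1 u) := (hG.exists_isGadget hu ha).choose_spec
  refine Finset.card_bij (fun a ha => (hG.exists_isGadget hu ha).choose)
    (fun a ha => ?_) (fun a ha a' ha' e => ?_) fun w hw => ?_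
  · exact Finset.mem_filter.2 ⟨Finset.mem_univ _, a, target a ha⟩
  · obtain ⟨b, h⟩ := target a ha
    obtain ⟨b', h'⟩ := target a' ha'
    exact hG.two_unique _ _ _ _ _ _ h (e ▸ h')
  · obtain ⟨a, b, h⟩ := (Finset.mem_filter.1 hw).2
    obtain ⟨b', h'⟩ := target a h.mem_labelNbrs_one
    exact ⟨a, h.mem_labelNbrs_one, (hG.isGadget_eq_of_two h h').2.2⟩

theorem outDegree_lt (hG : G.IsGadLin) (h : G.Represents u w) :
    G.outDegree w < G.outDegree u := by
  classical
  obtain ⟨a, b, hg⟩ := id h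
  rw [hG.outDegree_eq_card_represents hg.label_source,
    hG.outDegree_eq_card_represents hg.label_target]
  refine Finset.card_lt_card (Finset.ssubset_iff_of_subset ?_ |>.2 ⟨w, by simpa, ?_⟩)
  · exact Finset.monotone_filter_right _ fun x _ => hG.trans u w x h
  · simpa using hG.irrefl w

theorem injOn_outDegree (hG : G.IsGadLin) : Set.InjOn G.outDegree {v | G.label v 0 = true} := by
  intro u hu w hw degree_eq
  by_contra hne
  rcases hG.total u w hu hw hne with h | h
  · exact (hG.outDegree_lt h).ne' degree_eq
  · exact (hG.outDegree_lt h).ne degree_eq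

theorem map_twoDegree (hG : G.IsGadLin) (hu : G.label u 0 = true) :
    (G.labelNbrs 1 u).val.map G.twoDegree = Multiset.range (G.outDegree u) := by
  have nodup : ((G.labelNbrs 1 u).val.map G.twoDegree).Nodup := by
    refine Multiset.Nodup.map_on (fun a ha a' ha' e => ?_) (G.labelNbrs 1 u).nodup
    obtain ⟨w, b, h⟩ := hG.exists_isGadget hu ha
    obtain ⟨w', b', h'⟩ := hG.exists_isGadget hu ha'
    rw [hG.twoDegree_eq h, hG.twoDegree_eq h'] at e
    obtain rfl := hG.injOn_outDegree h.label_target h'.label_target e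
    exact hG.two_unique _ _ _ _ _ _ h h'
  refine Multiset.eq_of_le_of_card_le ((Multiset.le_iff_subset nodup).2 fun x hx => ?_) ?_
  · obtain ⟨a, ha, rfl⟩ := Multiset.mem_map.1 hx
    obtain ⟨w, b, h⟩ := hG.exists_isGadget hu ha
    rw [hG.twoDegree_eq h, Multiset.mem_range]
    exact hG.outDegree_lt ⟨a, b, h⟩
  · rw [Multiset.card_range, Multiset.card_map]
    rfl

end IsGadLin

theorem degreeCondition_iff_isGadLin {V : Type} [Fintype V] {G : LabelledGraph 3 V} :
    G.DegreeCondition ↔ G.IsGadLin :=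
  ⟨fun hG => hG.isGadLin, fun hG =>
    ⟨hG.localCondition, fun _ => hG.map_twoDegree, hG.injOn_outDegree⟩⟩

end LabelledGraph

section ACRComputable

open NodeFeature LabelledGraph

theorem isACRComputable_card_labelNbrs {d : ℕ} :
    IsACRComputable (fun _ _ G v => (G.label v, fun i => (G.labelNbrs i v).card) :
      NodeFeature d ((Fin d → Bool) × (Fin d → ℕ))) := by
  have label_unit : IsACRComputable (fun _ _ G v => (G.label v, ()) :
      NodeFeature d ((Fin d → Bool) × Unit)) :=
    isACRComputable_label.of_eq_comp (fun l => (l, ())) fun _ _ _ _ => rfl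
  refine label_unit.prod_labelNbrs.of_eq_comp (fun x => (x.1, fun i => (x.2.2 i).card))
    fun V _ G v => ?_
  simp only [Multiset.card_map, Finset.card_val]

theorem isACRComputable_threeDegree :
    IsACRComputable (fun _ _ G v =>
      (G.label v, (fun i => (G.labelNbrs i v).card), G.threeDegree v) :
      NodeFeature 3 ((Fin 3 → Bool) × (Fin 3 → ℕ) × ℕ)) := by
  refine isACRComputable_card_labelNbrs.prod_labelNbrs.of_eq_comp
    (fun x => (x.1, x.2.1, ((x.2.2 0).map fun c => c 1).sum)) fun V _ G v => ?_
  simp only [Multiset.map_map, Function.comp_def, threeDegree]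
  rfl

theorem isACRComputable_twoDegree :
    IsACRComputable (fun _ _ G v =>
      (G.label v, (fun i => (G.labelNbrs i v).card), G.twoDegree v) :
      NodeFeature 3 ((Fin 3 → Bool) × (Fin 3 → ℕ) × ℕ)) := by
  refine isACRComputable_threeDegree.prod_labelNbrs.of_eq_comp
    (fun x => (x.1, x.2.1.1, ((x.2.2 2).map Prod.snd).sum)) fun V _ G v => ?_
  simp only [Multiset.map_map, Function.comp_def, twoDegree]

/-- The part of `LabelledGraph.DegreeCondition` that concerns a single node. -/
def LabelledGraph.DegreeConditionAt {V : Type} [Fintype V] (G : LabelledGraph 3 V) (v : V) :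
    Prop :=
  LocalCondition (G.label v) (fun i => (G.labelNbrs i v).card) ∧ (G.label v 0 = true →
    (G.labelNbrs 1 v).val.map G.twoDegree = Multiset.range (G.outDegree v))

theorem isACRComputable_degreeConditionAt :
    IsACRComputable (fun _ _ G v => (G.label v, G.outDegree v, G.DegreeConditionAt v) :
      NodeFeature 3 ((Fin 3 → Bool) × ℕ × Prop)) := by
  refine isACRComputable_twoDegree.prod_labelNbrs.of_eq_comp
    (fun x => (x.1, x.2.1.1 1, LocalCondition x.1 x.2.1.1 ∧ (x.1 0 = true →
      (x.2.2 1).map Prod.snd = Multiset.range (x.2.1.1 1)))) fun V _ G v => ?_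
  simp only [DegreeConditionAt, Multiset.map_map, Function.comp_def, outDegree]

theorem degreeCondition_iff {V : Type} [Fintype V] {G : LabelledGraph 3 V} :
    G.DegreeCondition ↔ (∀ v, G.DegreeConditionAt v) ∧
      (((Finset.univ : Finset V).val.filter fun v => G.label v 0 = true).map
        G.outDegree).Nodup := by
  have injOn_iff : Set.InjOn G.outDegree {v | G.label v 0 = true} ↔
      (((Finset.univ : Finset V).val.filter fun v => G.label v 0 = true).map
        G.outDegree).Nodup := by
    rw [← Finset.filter_val, Finset.nodup_map_iff_injOn, Finset.coe_filter_univ]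
  rw [← injOn_iff]
  exact ⟨fun ⟨h₁, h₂, h₃⟩ => ⟨fun v => ⟨h₁ v, h₂ v⟩, h₃⟩,
    fun ⟨h, h'⟩ => ⟨fun v => (h v).1, fun v => (h v).2, h'⟩⟩

theorem isACRComputable_degreeCondition :
    IsACRComputable (fun _ _ G _ => G.DegreeCondition : NodeFeature 3 Prop) := by
  refine isACRComputable_degreeConditionAt.prod_nbrs_all.of_eq_comp
    (fun x => (∀ y ∈ x.2.2, y.2.2) ∧
      ((x.2.2.filter fun y => y.1 0 = true).map fun y => y.2.1).Nodup) fun V _ G v => propext ?_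
  simp only [degreeCondition_iff, NodeFeature.all, Multiset.filter_map, Multiset.map_map,
    Function.comp_def, Multiset.forall_mem_map_iff, Finset.mem_val, Finset.mem_univ,
    forall_const]

theorem acrExpressible_gadLin : ACRExpressible gadLin := by
  refine IsACRComputable.acrExpressible
    (isACRComputable_degreeCondition.of_eq_comp id fun V _ G v => propext ?_)
  exact gadLin_iff.trans degreeCondition_iff_isGadLin.symm

end ACRComputable

/-! ### The two-variable counting game -/

namespace C2Formula

variable {d : ℕ}

/-- The quantifier depth of a formula. -/
def depth : C2Formula d → ℕ
  | .equal _ _ => 0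
  | .edge _ _ => 0
  | .label _ _ => 0
  | .neg φ => φ.depth
  | .and φ ψ => max φ.depth ψ.depth
  | .existsAtLeast _ _ φ => φ.depth + 1

/-- The largest number that is used in a counting quantifier of a formula. -/
def maxCount : C2Formula d → ℕ
  | .equal _ _ => 0
  | .edge _ _ => 0
  | .label _ _ => 0
  | .neg φ => φ.maxCount
  | .and φ ψ => max φ.maxCount ψ.maxCount
  | .existsAtLeast k _ φ => max k φ.maxCount

end C2Formula

theorem exists_finset_card_eq_of_card_fiber_le {α β γ : Type*} [Fintype β] [DecidableEq γ]
    (s : Finset α) (f : α → γ) (g : β → γ)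
    (h : ∀ c, (s.filter fun a => f a = c).card ≤ (Finset.univ.filter fun b => g b = c).card) :
    ∃ t : Finset β, t.card = s.card ∧ ∀ b ∈ t, ∃ a ∈ s, f a = g b := by
  classical
  choose T hT card_T using fun c => Finset.exists_subset_card_eq (h c)
  have g_eq c b (hb : b ∈ T c) : g b = c := (Finset.mem_filter.1 (hT c hb)).2
  refine ⟨(s.image f).biUnion T, ?_, fun b hb => ?_⟩
  · rw [Finset.card_biUnion, Finset.card_eq_sum_card_image f s]
    · exact Finset.sum_congr rfl fun c _ => card_T c
    · exact fun c _ c' _ hne => Finset.disjoint_left.2 fun b hb hb' =>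
        hne ((g_eq c b hb).symm.trans (g_eq c' b hb'))
  · obtain ⟨c, hc, hb⟩ := Finset.mem_biUnion.1 hb
    obtain ⟨a, ha, rfl⟩ := Finset.mem_image.1 hc
    exact ⟨a, ha, (g_eq _ b hb).symm⟩

namespace LabelledGraph

section RelativeColour

variable {d : ℕ} {V W C : Type}

/-- The colour of a node `w` under `κ` together with the way in which `w` is related to `a`: a
two-variable formula sees no more of the pair `(a, w)` than this and the colour of `a`. -/
def relativeColour (G : LabelledGraph d V) (κ : V → C) (a w : V) : Prop × Prop × C :=
  (w = a, G.Adj a w, κ w)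

variable {G : LabelledGraph d V} {H : LabelledGraph d W} {κ : V → C} {κ' : W → C} {a w : V}
  {a' w' : W}

theorem relativeColour_eq_iff :
    G.relativeColour κ a w = H.relativeColour κ' a' w' ↔
      (w = a ↔ w' = a') ∧ (G.Adj a w ↔ H.Adj a' w') ∧ κ w = κ' w' := by
  simp only [relativeColour, Prod.mk.injEq, eq_iff_iff]

theorem relativeColour_self_eq_iff :
    G.relativeColour κ a a = H.relativeColour κ' a' a' ↔ κ a = κ' a' := by
  simp only [relativeColour_eq_iff, SimpleGraph.irrefl, true_and]

theorem relativeColour_swap (h : G.relativeColour κ a w = H.relativeColour κ' a' w')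
    (ha : κ a = κ' a') : G.relativeColour κ w a = H.relativeColour κ' w' a' := by
  rw [relativeColour_eq_iff] at h ⊢
  exact ⟨by rw [eq_comm, h.1, eq_comm], by rw [G.adj_comm, h.2.1, H.adj_comm], ha⟩

open Classical in
/-- The nodes of relative colour `c` with respect to `a`. -/
noncomputable def relativeClass [Fintype V] (G : LabelledGraph d V) (κ : V → C) (a : V)
    (c : Prop × Prop × C) : Finset V :=
  Finset.univ.filter fun w => G.relativeColour κ a w = c

/-- The neighbours of `a` of colour `c`. -/
noncomputable def adjClass [Fintype V] (G : LabelledGraph d V) (κ : V → C) (a : V) (c : C) :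
    Finset V :=
  G.relativeClass κ a (False, True, c)

/-- The nodes of colour `c` other than `a` that are not adjacent to `a`. -/
noncomputable def nonAdjClass [Fintype V] (G : LabelledGraph d V) (κ : V → C) (a : V) (c : C) :
    Finset V :=
  G.relativeClass κ a (False, False, c)

variable [Fintype V] {c : C}

theorem mem_relativeClass {c : Prop × Prop × C} :
    w ∈ G.relativeClass κ a c ↔ G.relativeColour κ a w = c := by
  simp only [relativeClass, Finset.mem_filter, Finset.mem_univ, true_and]

theorem mem_adjClass : w ∈ G.adjClass κ a c ↔ G.Adj a w ∧ κ w = c := by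
  simp only [adjClass, mem_relativeClass, relativeColour, Prod.mk.injEq, eq_iff_iff, iff_false,
    iff_true, and_iff_right_iff_imp]
  exact fun h => h.1.ne'

theorem mem_nonAdjClass : w ∈ G.nonAdjClass κ a c ↔ w ≠ a ∧ ¬ G.Adj a w ∧ κ w = c := by
  simp only [nonAdjClass, mem_relativeClass, relativeColour, Prod.mk.injEq, eq_iff_iff, iff_false,
    ne_eq]

open Classical in
theorem relativeClass_true (p : Prop) :
    G.relativeClass κ a (True, p, c) = if ¬ p ∧ κ a = c then {a} else ∅ := by
  ext w
  rw [mem_relativeClass, relativeColour, Prod.mk.injEq, Prod.mk.injEq, eq_iff_iff, iff_true]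
  split_ifs with h
  · rw [Finset.mem_singleton, and_iff_left_iff_imp]
    rintro rfl
    exact ⟨eq_false (G.loopless.irrefl w) |>.trans (eq_false h.1).symm, h.2⟩
  · refine iff_of_false ?_ (Finset.notMem_empty w)
    rintro ⟨rfl, rfl, hc⟩
    exact h ⟨G.loopless.irrefl w, hc⟩

open Classical in
theorem card_adjClass_add_card_nonAdjClass :
    (G.adjClass κ a c).card + (G.nonAdjClass κ a c).card =
      ((Finset.univ.filter fun w => κ w = c).erase a).card := by
  rw [← Finset.card_union_of_disjoint]
  · congr 1
    ext w
    rw [Finset.mem_union, mem_adjClass, mem_nonAdjClass, Finset.mem_erase, Finset.mem_filter]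
    have := G.ne_of_adj (a := a) (b := w)
    grind
  · refine Finset.disjoint_left.2 fun w hw hw' => ?_
    exact (mem_nonAdjClass.1 hw').2.1 (mem_adjClass.1 hw).1

theorem min_card_relativeClass_eq {G H : LabelledGraph d V} {k : ℕ} {x y : V} (hκ : κ x = κ y)
    (h : ∀ c, (G.adjClass κ x c).card = (H.adjClass κ y c).card ∨
      (k ≤ (G.adjClass κ x c).card ∧ k ≤ (G.nonAdjClass κ x c).card) ∧
        k ≤ (H.adjClass κ y c).card ∧ k ≤ (H.nonAdjClass κ y c).card)
    (c : Prop × Prop × C) :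
    min k (G.relativeClass κ x c).card = min k (H.relativeClass κ y c).card := by
  classical
  obtain ⟨p, q, c⟩ := c
  by_cases hp : p
  · rw [eq_true hp, relativeClass_true, relativeClass_true, hκ, apply_ite Finset.card,
      apply_ite Finset.card, Finset.card_singleton, Finset.card_singleton]
  rw [eq_false hp]
  have card_erase : ((Finset.univ.filter fun w => κ w = c).erase x).card =
      ((Finset.univ.filter fun w => κ w = c).erase y).card := by
    simp only [Finset.card_erase_eq_ite, Finset.mem_filter, Finset.mem_univ, true_and, hκ]
  rw [← card_adjClass_add_card_nonAdjClass (G := G),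
    ← card_adjClass_add_card_nonAdjClass (G := H)] at card_erase
  by_cases hq : q
  · rw [eq_true hq]
    change min k (G.adjClass κ x c).card = min k (H.adjClass κ y c).card
    have := h c
    omega
  · rw [eq_false hq]
    change min k (G.nonAdjClass κ x c).card = min k (H.nonAdjClass κ y c).card
    have := h c
    omega

end RelativeColour

end LabelledGraph

/-- Colourings `κ r` of two graphs that play the role of winning strategies for the duplicator in
the `r`-round two-variable counting game: nodes with the same colour at level `r + 1` see the same
number of nodes of each relative colour at level `r`, as far as counting up to `k` can tell. The
level ranges up to the number `q` of rounds. -/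
structure CappedColouring {d : ℕ} {V W C : Type} [Fintype V] [Fintype W] (G : LabelledGraph d V)
    (H : LabelledGraph d W) (k q : ℕ) (κ : ℕ → V → C) (κ' : ℕ → W → C) : Prop where
  label_eq : ∀ r x y, κ r x = κ' r y → G.label x = H.label y
  mono : ∀ r x y, κ (r + 1) x = κ' (r + 1) y → κ r x = κ' r y
  min_card_eq : ∀ r < q, ∀ x y, κ (r + 1) x = κ' (r + 1) y → ∀ c,
    min k (G.relativeClass (κ r) x c).card = min k (H.relativeClass (κ' r) y c).card

namespace CappedColouring

open LabelledGraph

variable {d : ℕ} {V W C : Type} [Fintype V] [Fintype W] {G : LabelledGraph d V}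
  {H : LabelledGraph d W} {k q r : ℕ} {κ : ℕ → V → C} {κ' : ℕ → W → C}

theorem symm (h : CappedColouring G H k q κ κ') : CappedColouring H G k q κ' κ where
  label_eq r x y e := (h.label_eq r y x e.symm).symm
  mono r x y e := (h.mono r y x e.symm).symm
  min_card_eq r hr x y e c := (h.min_card_eq r hr y x e.symm c).symm

theorem exists_finset (h : CappedColouring G H k q κ κ') (hr : r < q) {a : V} {b : W}
    (hab : κ (r + 1) a = κ' (r + 1) b) {P : V → Prop} {Q : W → Prop}
    (hPQ : ∀ x y, G.relativeColour (κ r) a x = H.relativeColour (κ' r) b y → P x → Q y)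
    {m : ℕ} (hm : m ≤ k) (hP : ∃ S : Finset V, S.card = m ∧ ∀ w ∈ S, P w) :
    ∃ S : Finset W, S.card = m ∧ ∀ w ∈ S, Q w := by
  classical
  obtain ⟨S, card_S, hP⟩ := hP
  obtain ⟨S', card_S', hS'⟩ := exists_finset_card_eq_of_card_fiber_le S
    (G.relativeColour (κ r) a) (H.relativeColour (κ' r) b) fun c => by
      calc (S.filter fun w => G.relativeColour (κ r) a w = c).card
        _ ≤ min k (G.relativeClass (κ r) a c).card :=
            le_min ((Finset.card_filter_le _ _).trans (card_S.le.trans hm))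
              (Finset.card_le_card fun w hw => mem_relativeClass.2 (Finset.mem_filter.1 hw).2)
        _ = min k (H.relativeClass (κ' r) b c).card := h.min_card_eq r hr a b hab c
        _ ≤ (H.relativeClass (κ' r) b c).card := min_le_right _ _
        _ = (Finset.univ.filter fun w => H.relativeColour (κ' r) b w = c).card := by
            congr 1
  refine ⟨S', card_S'.trans card_S, fun y hy => ?_⟩
  obtain ⟨x, hx, e⟩ := hS' y hy
  exact hPQ x y e (hP x hx)

theorem relativeColour_update_eq (h : CappedColouring G H k q κ κ') {s : Fin 2 → V}
    {t : Fin 2 → W} {i j : Fin 2} (hij : i ≠ j) (hst : κ (r + 1) (s j) = κ' (r + 1) (t j)) {x : V}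
    {y : W} (hxy : G.relativeColour (κ r) (s j) x = H.relativeColour (κ' r) (t j) y)
    (l m : Fin 2) :
    G.relativeColour (κ r) (Function.update s i x l) (Function.update s i x m) =
      H.relativeColour (κ' r) (Function.update t i y l) (Function.update t i y m) := by
  have κ_eq := h.mono r _ _ hst
  have eq_or n : n = i ∨ n = j := by omega
  rcases eq_or l with rfl | rfl <;> rcases eq_or m with rfl | rfl <;>
    simp only [Function.update_self, Function.update_of_ne hij.symm]
  · exact relativeColour_self_eq_iff.2 (relativeColour_eq_iff.1 hxy).2.2
  · exact relativeColour_swap hxy κ_eq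
  · exact hxy
  · exact relativeColour_self_eq_iff.2 κ_eq

theorem sat_iff (h : CappedColouring G H k q κ κ') (φ : C2Formula d) (hr : r ≤ q)
    (hd : φ.depth ≤ r) (hk : φ.maxCount ≤ k) {s : Fin 2 → V} {t : Fin 2 → W}
    (hst : ∀ i j, G.relativeColour (κ r) (s i) (s j) = H.relativeColour (κ' r) (t i) (t j)) :
    φ.Sat G s ↔ φ.Sat H t := by
  induction φ generalizing r s t with
  | equal i j => exact (relativeColour_eq_iff.1 (hst j i)).1
  | edge i j => exact (relativeColour_eq_iff.1 (hst i j)).2.1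
  | label p i =>
    simp only [C2Formula.Sat, h.label_eq r _ _ (relativeColour_eq_iff.1 (hst i i)).2.2]
  | neg φ ih => exact not_congr (ih hr hd hk hst)
  | and φ ψ ih₁ ih₂ =>
    exact and_congr (ih₁ hr ((le_max_left _ _).trans hd) ((le_max_left _ _).trans hk) hst)
      (ih₂ hr ((le_max_right _ _).trans hd) ((le_max_right _ _).trans hk) hst)
  | existsAtLeast m i φ ih =>
    obtain _ | r := r
    · exact absurd hd (Nat.not_succ_le_zero _)
    obtain ⟨j, hij⟩ : ∃ j, i ≠ j := (exists_ne i).imp fun _ => Ne.symm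
    have hj : κ (r + 1) (s j) = κ' (r + 1) (t j) := (relativeColour_eq_iff.1 (hst j j)).2.2
    have sat_update_iff x y
        (hxy : G.relativeColour (κ r) (s j) x = H.relativeColour (κ' r) (t j) y) :
        φ.Sat G (Function.update s i x) ↔ φ.Sat H (Function.update t i y) :=
      ih (Nat.le_of_succ_le hr) (Nat.le_of_succ_le_succ hd) ((le_max_right _ _).trans hk)
        (h.relativeColour_update_eq hij hj hxy)
    have hm : m ≤ k := (le_max_left _ _).trans hk
    exact ⟨h.exists_finset hr hj (fun x y e => (sat_update_iff x y e).1) hm,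
      h.symm.exists_finset hr hj.symm (fun y x e => (sat_update_iff x y e.symm).2) hm⟩

end CappedColouring

/-! ### Central positions of a long linear order -/

instance finite_gadNode {d : ℕ} {V : Type} [Finite V] (D : LabelledDigraph d V) :
    Finite (GadNode D) := by
  refine Finite.of_injective (β := Fin 3 × V × V) (fun
    | .one u => (0, u, u)
    | .two u w _ => (1, u, w)
    | .three u w _ => (2, u, w)) ?_
  rintro (_ | _ | _) (_ | _ | _) h <;> simp_all

/-- The strict linear order on `Fin N` as a directed graph. -/
def finOrder (N : ℕ) : LabelledDigraph 0 (Fin N) where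
  edge u w := u < w
  irrefl := lt_irrefl
  label _ i := i.elim0

section PositionColour

variable {N S T : ℕ}

/-- The colour of a position in `Fin N`: the positions at distance at least `T` from both ends
cannot be told apart and share the colour `none`. -/
def positionColour (T : ℕ) (i : Fin N) : Option (Fin N) :=
  if T ≤ i ∧ i + T < N then none else some i

theorem positionColour_eq_none {i : Fin N} : positionColour T i = none ↔ T ≤ i ∧ i + T < N := by
  simp only [positionColour, ite_eq_left_iff, reduceCtorEq, imp_false, not_not]

theorem positionColour_eq_some {i j : Fin N} :
    positionColour T i = some j ↔ i = j ∧ ¬ (T ≤ i ∧ i + T < N) := by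
  grind [positionColour]

theorem positionColour_eq_iff {i j : Fin N} :
    positionColour T i = positionColour T j ↔
      i = j ∨ (positionColour T i = none ∧ positionColour T j = none) := by
  grind [positionColour]

theorem positionColour_eq_none_of_le (h : S ≤ T) {i : Fin N} (hi : positionColour T i = none) :
    positionColour S i = none := by
  rw [positionColour_eq_none] at hi ⊢
  omega

theorem positionColour_mono (h : S ≤ T) {i j : Fin N}
    (e : positionColour T i = positionColour T j) : positionColour S i = positionColour S j := by
  rw [positionColour_eq_iff] at e ⊢
  exact e.imp_right (And.imp (positionColour_eq_none_of_le h) (positionColour_eq_none_of_le h))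

theorem exists_injective_central_gt {k : ℕ} {i : Fin N}
    (hi : positionColour (S + k + 2) i = none) :
    ∃ p : Fin k → Fin N, p.Injective ∧ ∀ t, i < p t ∧ positionColour S (p t) = none := by
  rw [positionColour_eq_none] at hi
  refine ⟨fun t => ⟨i + 1 + t, by omega⟩, fun t t' e => ?_, fun t => ⟨?_, ?_⟩⟩
  · simpa only [Fin.mk.injEq, Nat.add_left_cancel_iff, Fin.val_inj] using e
  all_goals
    simp only [Fin.lt_def, positionColour_eq_none]
    omega

theorem exists_injective_central_lt {k : ℕ} {i : Fin N}
    (hi : positionColour (S + k + 2) i = none) :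
    ∃ (p : Fin k → Fin N) (e : Fin N), p.Injective ∧ e < i ∧ positionColour S e = none ∧
      ∀ t, p t < e ∧ p t < S + k + 2 ∧ positionColour S (p t) = none := by
  rw [positionColour_eq_none] at hi
  refine ⟨fun t => ⟨S + t, by omega⟩, ⟨S + k + 1, by omega⟩, fun t t' e => ?_, ?_, ?_,
    fun t => ⟨?_, ?_, ?_⟩⟩
  · simpa only [Fin.mk.injEq, Nat.add_left_cancel_iff, Fin.val_inj] using e
  all_goals
    simp only [Fin.lt_def, positionColour_eq_none]
    omega

/-- Redirections of gadgets that a colouring of positions up to distance `T` does not notice: the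
end of a gadget is moved only between positions at distance at least `T` from both ends. -/
def CentralRedirection (T : ℕ) (τ : Fin N → Fin N → Fin N) : Prop :=
  ∀ u w, τ u w = w ∨ (T ≤ u ∧ positionColour T w = none ∧ positionColour T (τ u w) = none)

namespace CentralRedirection

variable {τ : Fin N → Fin N → Fin N} {u w i : Fin N}

theorem positionColour_eq (hτ : CentralRedirection T τ) (h : S ≤ T) (u w : Fin N) :
    positionColour S (τ u w) = positionColour S w := by
  rcases hτ u w with e | ⟨-, e, e'⟩
  · rw [e]
  · exact positionColour_mono h (e'.trans e.symm)

theorem eq_of_lt (hτ : CentralRedirection T τ) (h : u < T) : τ u w = w :=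
  (hτ u w).resolve_right fun e => absurd e.1 (by omega)

theorem eq_iff (hτ : CentralRedirection T τ) (hi : positionColour T i ≠ none) :
    τ u w = i ↔ w = i := by
  rcases hτ u w with e | ⟨-, e, e'⟩
  · rw [e]
  · constructor <;> rintro rfl <;> contradiction

end CentralRedirection

end PositionColour

section GadColour

variable {N S T : ℕ}

/-- The colour of a node of the gadgetisation of a linear order: its label and the colours of the
positions that it belongs to. -/
def gadColour (T : ℕ) : GadNode (finOrder N) → Fin 3 × Option (Fin N) × Option (Fin N)
  | .one u => (0, positionColour T u, none)
  | .two u w _ => (1, positionColour T u, positionColour T w)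
  | .three u w _ => (2, positionColour T u, positionColour T w)

theorem gad_label_eq_of_gadColour_eq {x y : GadNode (finOrder N)}
    (e : gadColour T x = gadColour T y) :
    (gad (finOrder N)).label x = (gad (finOrder N)).label y := by
  rcases x with _ | _ | _ <;> rcases y with _ | _ | _ <;> simp [gadColour, gad] at e ⊢

theorem gadColour_mono (h : S ≤ T) {x y : GadNode (finOrder N)}
    (e : gadColour T x = gadColour T y) : gadColour S x = gadColour S y := by
  rcases x with _ | _ | _ <;> rcases y with _ | _ | _ <;>
    simp only [gadColour, Prod.mk.injEq, true_and, and_true] at e ⊢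
  case one.one => exact positionColour_mono h e
  case two.two | three.three => exact e.imp (positionColour_mono h) (positionColour_mono h)
  all_goals exact absurd e.1 (by decide)

end GadColour

namespace LabelledGraph

open Classical in
theorem card_adjClass_of_adj_iff {d : ℕ} {V C : Type} [Fintype V] {G : LabelledGraph d V}
    {κ : V → C} {a x y : V} (hxy : x ≠ y) (hadj : ∀ z, G.Adj a z ↔ z = x ∨ z = y) (c : C) :
    (G.adjClass κ a c).card = (if κ x = c then 1 else 0) + if κ y = c then 1 else 0 := by
  have adjClass_eq : G.adjClass κ a c = ({x, y} : Finset V).filter fun z => κ z = c := by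
    ext z
    rw [mem_adjClass, hadj, Finset.mem_filter, Finset.mem_insert, Finset.mem_singleton]
  rw [adjClass_eq, Finset.card_filter, Finset.sum_pair hxy]

end LabelledGraph

theorem le_card_of_injective {α : Type*} {s : Finset α} {k : ℕ} {f : Fin k → α}
    (hf : f.Injective) (hs : ∀ t, f t ∈ s) : k ≤ s.card := by
  simpa only [Finset.card_univ, Fintype.card_fin] using
    Finset.card_le_card_of_injOn (s := Finset.univ) f (fun t _ => hs t) hf.injOn

section ColourCounts

open LabelledGraph

variable {N : ℕ} [Fintype (GadNode (finOrder N))] {τ τ' : Fin N → Fin N → Fin N} {k S T : ℕ}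
  {i i' u w u' w' : Fin N} {c : Fin 3 × Option (Fin N) × Option (Fin N)}

theorem card_adjClass_two_eq {h : (finOrder N).edge u w} {h' : (finOrder N).edge u' w'}
    (e : gadColour S (.two u w h) = gadColour S (.two u' w' h')) :
    ((redirect (finOrder N) τ).adjClass (gadColour S) (.two u w h) c).card =
      ((redirect (finOrder N) τ').adjClass (gadColour S) (.two u' w' h') c).card := by
  simp only [gadColour, Prod.mk.injEq, true_and] at e
  rw [card_adjClass_of_adj_iff (by simp) fun _ => redirect_adj_two,
    card_adjClass_of_adj_iff (by simp) fun _ => redirect_adj_two]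
  simp only [gadColour, e]
  congr

theorem card_adjClass_three_eq (hτ : CentralRedirection T τ) (hτ' : CentralRedirection T τ')
    (hST : S ≤ T) {h : (finOrder N).edge u w} {h' : (finOrder N).edge u' w'}
    (e : gadColour S (.three u w h) = gadColour S (.three u' w' h')) :
    ((redirect (finOrder N) τ).adjClass (gadColour S) (.three u w h) c).card =
      ((redirect (finOrder N) τ').adjClass (gadColour S) (.three u' w' h') c).card := by
  simp only [gadColour, Prod.mk.injEq, true_and] at e
  rw [card_adjClass_of_adj_iff (by simp) fun _ => redirect_adj_three,
    card_adjClass_of_adj_iff (by simp) fun _ => redirect_adj_three]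
  simp only [gadColour, hτ.positionColour_eq hST, hτ'.positionColour_eq hST, e]
  congr

theorem adjClass_one_eq (hτ : CentralRedirection T τ) (hτ' : CentralRedirection T τ')
    (hi : positionColour T i ≠ none) :
    (redirect (finOrder N) τ).adjClass (gadColour S) (.one i) c =
      (redirect (finOrder N) τ').adjClass (gadColour S) (.one i) c := by
  ext z
  simp only [mem_adjClass, redirect_adj_one, hτ.eq_iff hi, hτ'.eq_iff hi]

/-- The colours of the gadgets that join a central position to one of the last `S` positions, or
one of the first `S` positions to a central one. -/
def IsOuterColour (S : ℕ) (c : Fin 3 × Option (Fin N) × Option (Fin N)) : Prop :=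
  (∃ l : Fin N, N ≤ l + S ∧ c = (1, none, some l)) ∨
    ∃ u : Fin N, u < S ∧ c = (2, some u, none)

theorem mem_adjClass_one_iff_of_central (hτ : CentralRedirection T τ) (hST : S ≤ T)
    (hi : positionColour S i = none) (hc₁ : c ≠ (1, none, none)) (hc₂ : c ≠ (2, none, none))
    {z : GadNode (finOrder N)} :
    z ∈ (redirect (finOrder N) τ).adjClass (gadColour S) (.one i) c ↔
      (∃ l h, z = .two i l h ∧ N ≤ l + S ∧ c = (1, none, some l)) ∨
        ∃ u h, z = .three u i h ∧ u < S ∧ c = (2, some u, none) := by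
  have hiS := positionColour_eq_none.1 hi
  rw [mem_adjClass, redirect_adj_one]
  constructor
  · rintro ⟨⟨l, h, rfl⟩ | ⟨u, l, h, rfl, e⟩, rfl⟩
    · rw [gadColour, hi] at hc₁ ⊢
      have hl : positionColour S l ≠ none := fun e => hc₁ (by rw [e])
      have hil : i < l := h
      rw [Ne, positionColour_eq_none] at hl
      rw [positionColour_eq_some.2 ⟨rfl, hl⟩]
      exact .inl ⟨l, h, rfl, by omega, rfl⟩
    · have hl : positionColour S l = none := by rw [← hτ.positionColour_eq hST u, e, hi]
      rw [gadColour, hl] at hc₂ ⊢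
      have hu : positionColour S u ≠ none := fun e => hc₂ (by rw [e])
      have hul : u < l := h
      rw [positionColour_eq_none] at hl
      rw [Ne, positionColour_eq_none] at hu
      have huS : u < S := by omega
      obtain rfl : l = i := (hτ.eq_of_lt (huS.trans_le hST)).symm.trans e
      rw [positionColour_eq_some.2 ⟨rfl, hu⟩]
      exact .inr ⟨u, h, rfl, huS, rfl⟩
  · rintro (⟨l, h, rfl, hl, rfl⟩ | ⟨u, h, rfl, hu, rfl⟩)
    · rw [gadColour, hi, positionColour_eq_some.2 ⟨rfl, by omega⟩]
      exact ⟨.inl ⟨l, h, rfl⟩, rfl⟩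
    · rw [gadColour, hi, positionColour_eq_some.2 ⟨rfl, by omega⟩]
      exact ⟨.inr ⟨u, i, h, rfl, hτ.eq_of_lt (by omega)⟩, rfl⟩

open Classical in
theorem card_adjClass_one_of_central (hτ : CentralRedirection T τ) (hST : S ≤ T)
    (hi : positionColour S i = none) (hc₁ : c ≠ (1, none, none)) (hc₂ : c ≠ (2, none, none)) :
    ((redirect (finOrder N) τ).adjClass (gadColour S) (.one i) c).card =
      if IsOuterColour S c then 1 else 0 := by
  have mem_iff {z} := mem_adjClass_one_iff_of_central (z := z) hτ hST hi hc₁ hc₂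
  rw [positionColour_eq_none] at hi
  split_ifs with hc
  · rw [Finset.card_eq_one]
    rcases hc with ⟨l, hl, rfl⟩ | ⟨u, hu, rfl⟩
    · have h : i < l := by omega
      refine ⟨.two i l h, Finset.eq_singleton_iff_unique_mem.2 ⟨mem_iff.2 ?_, fun z hz => ?_⟩⟩
      · exact .inl ⟨l, h, rfl, hl, rfl⟩
      · rcases mem_iff.1 hz with ⟨l, _, rfl, -, e⟩ | ⟨u, _, -, -, e⟩ <;> cases e
        rfl
    · have h : u < i := by omega
      refine ⟨.three u i h, Finset.eq_singleton_iff_unique_mem.2 ⟨mem_iff.2 ?_, fun z hz => ?_⟩⟩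
      · exact .inr ⟨u, h, rfl, hu, rfl⟩
      · rcases mem_iff.1 hz with ⟨l, _, -, -, e⟩ | ⟨u, _, rfl, -, e⟩ <;> cases e
        rfl
  · refine Finset.card_eq_zero.2 (Finset.eq_empty_of_forall_notMem fun z hz => hc ?_)
    rcases mem_iff.1 hz with ⟨l, _, -, hl, rfl⟩ | ⟨u, _, -, hu, rfl⟩
    exacts [.inl ⟨l, hl, rfl⟩, .inr ⟨u, hu, rfl⟩]

theorem le_card_adjClass_one (hτ : CentralRedirection T τ) (hST : S + k + 2 ≤ T)
    (hi : positionColour (S + k + 2) i = none) (hc : c = (1, none, none) ∨ c = (2, none, none)) :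
    k ≤ ((redirect (finOrder N) τ).adjClass (gadColour S) (.one i) c).card := by
  have hiS : positionColour S i = none := positionColour_eq_none_of_le (by omega) hi
  rcases hc with rfl | rfl
  · obtain ⟨p, injective_p, hp⟩ := exists_injective_central_gt hi
    refine le_card_of_injective (f := fun t => .two i (p t) (hp t).1) (fun t t' e => ?_) fun t => ?_
    · exact injective_p (GadNode.two.inj e).2
    · simp only [mem_adjClass, redirect_adj_one, gadColour, hiS, (hp t).2, and_true]
      exact .inl ⟨_, _, rfl⟩
  · obtain ⟨p, e, injective_p, hei, -, hp⟩ := exists_injective_central_lt hi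
    refine le_card_of_injective (f := fun t => .three (p t) i ((hp t).1.trans hei))
      (fun t t' e => ?_) fun t => ?_
    · exact injective_p (GadNode.three.inj e).1
    · simp only [mem_adjClass, redirect_adj_one, gadColour, hiS, (hp t).2.2, and_true]
      exact .inr ⟨_, _, _, rfl, hτ.eq_of_lt ((hp t).2.1.trans_le hST)⟩

theorem le_card_nonAdjClass_one (hτ : CentralRedirection T τ) (hST : S + k + 2 ≤ T)
    (hi : positionColour (S + k + 2) i = none) (hc : c = (1, none, none) ∨ c = (2, none, none)) :
    k ≤ ((redirect (finOrder N) τ).nonAdjClass (gadColour S) (.one i) c).card := by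
  obtain ⟨p, e, injective_p, hei, he, hp⟩ := exists_injective_central_lt hi
  rcases hc with rfl | rfl
  · refine le_card_of_injective (f := fun t => .two (p t) e (hp t).1) (fun t t' e => ?_) fun t => ?_
    · exact injective_p (GadNode.two.inj e).1
    · simp only [mem_nonAdjClass, redirect_adj_one, gadColour, he, (hp t).2.2, and_true]
      refine ⟨nofun, ?_⟩
      rintro (⟨l, h, eq⟩ | ⟨u, l, h, eq, -⟩) <;> cases eq
      exact ((hp t).1.trans hei).false
  · refine le_card_of_injective (f := fun t => .three (p t) e (hp t).1)
      (fun t t' e => ?_) fun t => ?_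
    · exact injective_p (GadNode.three.inj e).1
    · simp only [mem_nonAdjClass, redirect_adj_one, gadColour, he, (hp t).2.2, and_true]
      refine ⟨nofun, ?_⟩
      rintro (⟨l, h, eq⟩ | ⟨u, l, h, eq, hl⟩) <;> cases eq
      exact hei.ne ((hτ.eq_of_lt ((hp t).2.1.trans_le hST)).symm.trans hl)

theorem card_adjClass_one (hτ : CentralRedirection T τ) (hτ' : CentralRedirection T τ')
    (hST : S + k + 2 ≤ T) (hi : positionColour (S + k + 2) i = none)
    (hi' : positionColour (S + k + 2) i' = none) :
    let G := redirect (finOrder N) τ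
    let H := redirect (finOrder N) τ'
    let κ := gadColour S
    (G.adjClass κ (.one i) c).card = (H.adjClass κ (.one i') c).card ∨
      (k ≤ (G.adjClass κ (.one i) c).card ∧ k ≤ (G.nonAdjClass κ (.one i) c).card) ∧
        k ≤ (H.adjClass κ (.one i') c).card ∧ k ≤ (H.nonAdjClass κ (.one i') c).card := by
  by_cases hc : c = (1, none, none) ∨ c = (2, none, none)
  · exact .inr ⟨⟨le_card_adjClass_one hτ hST hi hc, le_card_nonAdjClass_one hτ hST hi hc⟩,
      le_card_adjClass_one hτ' hST hi' hc, le_card_nonAdjClass_one hτ' hST hi' hc⟩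
  · obtain ⟨hc₁, hc₂⟩ := not_or.1 hc
    have hS : S ≤ S + k + 2 := by omega
    have hiS := positionColour_eq_none_of_le hS hi
    have hiS' := positionColour_eq_none_of_le hS hi'
    exact .inl ((card_adjClass_one_of_central hτ (hS.trans hST) hiS hc₁ hc₂).trans
      (card_adjClass_one_of_central hτ' (hS.trans hST) hiS' hc₁ hc₂).symm)

theorem card_adjClass_redirect (hτ : CentralRedirection T τ) (hτ' : CentralRedirection T τ')
    (hST : S + k + 2 ≤ T) {x y : GadNode (finOrder N)}
    (e : gadColour (S + k + 2) x = gadColour (S + k + 2) y) :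
    let G := redirect (finOrder N) τ
    let H := redirect (finOrder N) τ'
    let κ := gadColour S
    (G.adjClass κ x c).card = (H.adjClass κ y c).card ∨
      (k ≤ (G.adjClass κ x c).card ∧ k ≤ (G.nonAdjClass κ x c).card) ∧
        k ≤ (H.adjClass κ y c).card ∧ k ≤ (H.nonAdjClass κ y c).card := by
  have hS : S ≤ S + k + 2 := by omega
  have e' := gadColour_mono hS e
  rcases x with i | ⟨u, w, h⟩ | ⟨u, w, h⟩ <;> rcases y with i' | ⟨u', w', h'⟩ | ⟨u', w', h'⟩
  case one.one =>
    have hii' : positionColour (S + k + 2) i = positionColour (S + k + 2) i' :=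
      congrArg (·.2.1) e
    by_cases hi : positionColour (S + k + 2) i = none
    · exact card_adjClass_one hτ hτ' hST hi (hii'.symm.trans hi)
    · obtain rfl := (positionColour_eq_iff.1 hii').resolve_right fun h => hi h.1
      refine .inl (congrArg Finset.card (adjClass_one_eq hτ hτ' fun hiT => hi ?_))
      exact positionColour_eq_none_of_le hST hiT
  case two.two => exact .inl (card_adjClass_two_eq e')
  case three.three => exact .inl (card_adjClass_three_eq hτ hτ' (hS.trans hST) e')
  all_goals simp [gadColour] at e

theorem cappedColouring_redirect (k q : ℕ) (hτ : CentralRedirection ((k + 2) * q) τ)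
    (hτ' : CentralRedirection ((k + 2) * q) τ') :
    CappedColouring (redirect (finOrder N) τ) (redirect (finOrder N) τ') k q
      (fun r => gadColour ((k + 2) * r)) (fun r => gadColour ((k + 2) * r)) where
  label_eq r x y e := gad_label_eq_of_gadColour_eq e
  mono r x y e := gadColour_mono (Nat.mul_le_mul_left _ (Nat.le_succ r)) e
  min_card_eq r hr x y e c := by
    have e' := gadColour_mono (Nat.mul_le_mul_left _ (Nat.le_succ r)) e
    have hST : (k + 2) * r + k + 2 ≤ (k + 2) * q := by
      rw [add_assoc, ← Nat.mul_succ]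
      exact Nat.mul_le_mul_left _ hr
    rw [Nat.mul_succ, ← add_assoc] at e
    exact min_card_relativeClass_eq e' (fun c => card_adjClass_redirect hτ hτ' hST e) c

end ColourCounts

theorem not_isGadLin_redirect {d : ℕ} {V : Type} {D : LabelledDigraph d V} {τ : V → V → V}
    {a b : V} (hab : D.edge a b) (hτ : τ a b = a) : ¬ (redirect D τ).IsGadLin := fun h =>
  h.irrefl (.one a) ⟨.two a b hab, .three a b hab, rfl, rfl, rfl, rfl,
    redirect_adj_one.2 (.inl ⟨_, _, rfl⟩), redirect_adj_two.2 (.inr rfl),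
    redirect_adj_three.2 (.inr (by rw [hτ]))⟩

theorem not_c2Expressible_gadLin : ¬ C2Expressible gadLin := by
  rintro ⟨φ, -, hφ⟩
  let T := (φ.maxCount + 2) * φ.depth
  let a : Fin (2 * T + 2) := ⟨T, by omega⟩
  let b : Fin (2 * T + 2) := ⟨T + 1, by omega⟩
  let τ : Fin (2 * T + 2) → Fin (2 * T + 2) → Fin (2 * T + 2) := fun u w =>
    if u = a ∧ w = b then a else w
  have hab : (finOrder _).edge a b := Fin.mk_lt_mk.2 (Nat.lt_succ_self T)
  have τ_ab : τ a b = a := if_pos ⟨rfl, rfl⟩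
  have ha : positionColour T a = none := positionColour_eq_none.2 (by dsimp only [a]; omega)
  have hb : positionColour T b = none := positionColour_eq_none.2 (by dsimp only [b]; omega)
  have central_snd : CentralRedirection T fun _ w : Fin (2 * T + 2) => w := fun _ _ => .inl rfl
  have central_τ : CentralRedirection T τ := by
    intro u w
    by_cases h : u = a ∧ w = b
    · rw [h.1, h.2, τ_ab]
      exact .inr ⟨le_rfl, hb, ha⟩
    · exact .inl (if_neg h)
  let _ := Fintype.ofFinite (GadNode (finOrder (2 * T + 2)))
  have sat_iff : φ.Sat (redirect (finOrder _) fun _ w => w) (fun _ => .one a) ↔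
      φ.Sat (redirect (finOrder _) τ) (fun _ => .one a) :=
    (cappedColouring_redirect φ.maxCount φ.depth central_snd central_τ).sat_iff φ le_rfl le_rfl
      le_rfl fun _ _ => LabelledGraph.relativeColour_self_eq_iff.2 rfl
  have isGadLin_snd : (redirect (finOrder (2 * T + 2)) fun _ w => w).IsGadLin :=
    redirect_snd_eq_gad ▸ isGadLin_gad (inferInstanceAs (IsStrictTotalOrder (Fin _) (· < ·)))
  exact not_isGadLin_redirect hab τ_ab
    (gadLin_iff.1 ((hφ _ _ _).1 (sat_iff.1 ((hφ _ _ _).2 (gadLin_iff.2 isGadLin_snd)))))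

theorem NodeClassifier.Agree.eq {d : ℕ} {A B : NodeClassifier d} (h : A.Agree B) : A = B := by
  funext V _ G v
  exact propext (h V G v)

theorem mainTheorem9 :
    (∃ φ : FOFormula 3, ACRExpressible φ.classifier ∧ ¬ C2Expressible φ.classifier) ∧
    (FOExpressible gadLin ∧ ACRExpressible gadLin ∧ ¬ C2Expressible gadLin) ∧
    ¬ (∀ (d : ℕ) (A : NodeClassifier d),
        (FOExpressible A ∧ ACRExpressible A) ↔ C2Expressible A) := by
  refine ⟨?_, ⟨foExpressible_gadLin, acrExpressible_gadLin, not_c2Expressible_gadLin⟩, fun h =>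
    not_c2Expressible_gadLin ((h 3 gadLin).1 ⟨foExpressible_gadLin, acrExpressible_gadLin⟩)⟩
  obtain ⟨φ, hφ⟩ := foExpressible_gadLin
  refine ⟨φ, ?_⟩
  rw [hφ.eq]
  exact ⟨acrExpressible_gadLin, not_c2Expressible_gadLin⟩
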